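/- Let $n\ge 1$ and let $B$ be the open unit ball of $\mathbb R^n$. Let $\lambda_1$ be the smallest eigenvalue of $-\Delta$ on $B$ with zero Dirichlet boundary condition, and let $x\mapsto\varphi_1(|x|)$ be the corresponding radial (principal) eigenfunction, normalized by $\varphi_1(0)=1$; thus $\Delta u+\lambda_1u=0$ in $B$ and $u=0$ on $\partial B$ for $u(x)=\varphi_1(|x|)$. Put $$J(\xi)=\int_0^1\sin\bigl(\xi\varphi_1(r)\bigr)\,\varphi_1(r)\,r^{n-1}\,dr .$$ Then $J$ changes sign infinitely many times on $(0,\infty)$ if $1\le n\le 5$, and only finitely many times if $n\ge 6$. (The number of sign changes of $J$ on $(0,\infty)$ is the supremum of all $k$ for which there are $0<x_0<\dots<x_k$ with $J(x_{i})J(x_{i+1})<0$ for $0\le i<k$.) Moreover, as $\xi\to\infty$: - $n=1$: $J(\xi)=\sqrt{\dfrac{\pi}{2\lambda_1}}\;\xi^{-1/2}\sin\bigl(\xi-\tfrac{\pi}{4}\bigr)+O(\xi^{-1})$; - $n=2$: $J(\xi)=-\dfrac{2}{\lambda_1}\,\xi^{-1}\cos\xi+O(\xi^{-3/2})$; - $n=3$: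 $J(\xi)=-\dfrac{3}{\lambda_1}\sqrt{\dfrac{3\pi}{2\lambda_1}}\;\xi^{-3/2}\cos\bigl(\xi-\tfrac{\pi}{4}\bigr)+O(\xi^{-2})$; - $n=4$: $J(\xi)=-\dfrac{32}{\lambda_1^2}\,\xi^{-2}\sin\xi+O(\xi^{-5/2})$; - $n=5$: $J(\xi)=-\dfrac{75}{\lambda_1^2}\sqrt{\dfrac{5\pi}{2\lambda_1}}\;\xi^{-5/2}\sin\bigl(\xi-\tfrac{\pi}{4}\bigr)+O(\xi^{-3})$; - $n=6$: $J(\xi)=\xi^{-3}\left(\dfrac{20}{\varphi_1'(1)^2}+\dfrac{1728}{\lambda_1^3}\cos\xi\right)+O(\xi^{-7/2})$, where $\dfrac{1728}{\lambda_1^3}<\dfrac{20}{\varphi_1'(1)^2}$; - $n\ge 7$: $J(\xi)\sim\dfrac{4(n-1)}{\varphi_1'(1)^2}\,\xi^{-3}$, where $\varphi_1'(1)\ne 0$. Here $\varphi_1'(1)$ is the one-sided derivative of $\varphi_1$ on $[0,1]$ at $1$. -/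

import Mathlib

open Set Filter Asymptotics

/-- `u` is a (real, classical) eigenfunction of the Dirichlet Laplacian on the open unit ball of
`ℝⁿ`, with eigenvalue `lam`: it is `C²` in the ball, continuous up to the boundary, not identically
zero, `Δ u + lam u = 0` in the ball and `u = 0` on the boundary sphere. Only the values of `u` on
the closed unit ball matter. -/
structure IsDirichletEigenpair (n : ℕ) (lam : ℝ) (u : EuclideanSpace ℝ (Fin n) → ℝ) : Prop where
  contDiffOn : ContDiffOn ℝ 2 u (Metric.ball 0 1)
  continuousOn : ContinuousOn u (Metric.closedBall 0 1)
  equation : ∀ x ∈ Metric.ball (0 : EuclideanSpace ℝ (Fin n)) 1, Laplacian.laplacian u x + lam * u x = 0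
  boundary : ∀ x ∈ Metric.sphere (0 : EuclideanSpace ℝ (Fin n)) 1, u x = 0
  nontrivial : ∃ x ∈ Metric.ball (0 : EuclideanSpace ℝ (Fin n)) 1, u x ≠ 0

/-- `(lam, u)` is a principal eigenpair: `lam` is the smallest Dirichlet eigenvalue of the unit
ball, and `u` is an eigenfunction for it. -/
structure IsPrincipalDirichletEigenpair (n : ℕ) (lam : ℝ) (u : EuclideanSpace ℝ (Fin n) → ℝ) :
    Prop extends IsDirichletEigenpair n lam u where
  least : ∀ (mu : ℝ) (v : EuclideanSpace ℝ (Fin n) → ℝ), IsDirichletEigenpair n mu v → lam ≤ mu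

/-- `φ` is the radial profile, normalized by `φ 0 = 1`, of the principal Dirichlet eigenfunction
`x ↦ φ ‖x‖` of the unit ball of `ℝⁿ`, and `lam` is the principal eigenvalue. -/
def IsPrincipalRadialProfile (n : ℕ) (lam : ℝ) (φ : ℝ → ℝ) : Prop :=
  IsPrincipalDirichletEigenpair n lam (fun x => φ ‖x‖) ∧ φ 0 = 1

/-- The oscillating integral `J(ξ) = ∫₀¹ sin(ξ φ(r)) φ(r) r^(n-1) dr`. -/
noncomputable def oscIntegral (n : ℕ) (φ : ℝ → ℝ) (ξ : ℝ) : ℝ :=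
  ∫ r in (0 : ℝ)..1, Real.sin (ξ * φ r) * φ r * r ^ (n - 1)

/-- `F` has at least `k` sign changes on `S`: there are points `x₀ < x₁ < ⋯ < x_k` of `S` such that
`F` takes non-zero values of opposite signs at any two consecutive ones. -/
def HasSignChanges (F : ℝ → ℝ) (S : Set ℝ) (k : ℕ) : Prop :=
  ∃ x : Fin (k + 1) → ℝ, StrictMono x ∧ (∀ i, x i ∈ S) ∧
    ∀ i : Fin k, F (x i.castSucc) * F (x i.succ) < 0

/-- The number of sign changes of `F` on `S`, possibly `⊤` (infinitely many). -/
noncomputable def numSignChanges (F : ℝ → ℝ) (S : Set ℝ) : ℕ∞ :=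
  ⨆ k ∈ {k : ℕ | HasSignChanges F S k}, (k : ℕ∞)

/-! In the variable `t = r²` the profile is `φ(r) = F(r²)`, with `F` an everywhere convergent power
series solving `4tF'' + 2nF' + λF = 0`, `F 0 = 1`, `F 1 = 0` and `F' < 0` on `[0, 1]`. Hence the
phase `ξ F(r²)` is stationary only at `r = 0`, where it is nondegenerate, and `J` is governed by the
origin and the endpoint `r = 1`.

Integration by parts against `r F'(r²)` gains a factor `1/ξ` and lowers the power of `r` by two. The
origin is therefore felt only at order `ξ^(-n/2)`: for odd `n` the power drops to `r⁰` and a Fresnel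
integral appears; for even `n` it drops to `r¹` and the next boundary term at `0` survives. Since `F
0 = 1`, this contribution oscillates like a shifted sine of `ξ`.

At `r = 1` the phase vanishes, so nothing oscillates there. The first boundary term is zero because
the amplitude `F` vanishes at `1`, the second because it carries `sin(-π)`; the third gives
`4(n-1)/φ'(1)² · ξ⁻³`.

So the origin dominates for `n ≤ 5` and the boundary for `n ≥ 7`. For `n = 6` the two tie, and the
boundary wins because `λ ≥ 2n = 12` and `φ'(1)² ≤ λ`. An oscillating leading term forces infinitely
many sign changes. A positive one confines the zeros of `J` to a bounded set, where they are finite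
in number since `J` is real analytic. -/

open scoped Topology

/-! ### The Laplacian along lines, and scaling of eigenfunctions -/

/-- The second derivative of a `C²` function along a line. -/
theorem ContDiffAt.deriv_deriv_line {E : Type*} [NormedAddCommGroup E] [NormedSpace ℝ E]
    {u : E → ℝ} {x : E} (hu : ContDiffAt ℝ 2 u x) (e : E) :
    deriv (deriv fun t : ℝ => u (x + t • e)) 0 = iteratedFDeriv ℝ 2 u x ![e, e] := by
  have hline : ∀ t : ℝ, HasDerivAt (fun s : ℝ => x + s • e) e t := fun t => by
    simpa using ((hasDerivAt_id t).smul_const e).const_add x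
  have hev : ∀ᶠ y in 𝓝 x, DifferentiableAt ℝ u y := by
    filter_upwards [hu.eventually (by simp)] with y hy using hy.differentiableAt (by simp)
  have hc : Tendsto (fun t : ℝ => x + t • e) (𝓝 0) (𝓝 x) := by
    have : ContinuousAt (fun t : ℝ => x + t • e) 0 := (hline 0).continuousAt
    simpa [ContinuousAt] using this
  have h1 : deriv (fun t : ℝ => u (x + t • e)) =ᶠ[𝓝 0] fun t => fderiv ℝ u (x + t • e) e := by
    filter_upwards [hc.eventually hev] with t ht
    exact (ht.hasFDerivAt.comp_hasDerivAt t (hline t)).deriv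
  rw [h1.deriv_eq, iteratedFDeriv_two_apply]
  have h2 : DifferentiableAt ℝ (fderiv ℝ u) (x + (0 : ℝ) • e) := by
    have := (hu.fderiv_right (m := 1) (by norm_num)).differentiableAt (by simp)
    simpa using this
  have h3 : HasDerivAt (fun t : ℝ => fderiv ℝ u (x + t • e))
      (fderiv ℝ (fderiv ℝ u) (x + (0 : ℝ) • e) e) 0 :=
    h2.hasFDerivAt.comp_hasDerivAt (0 : ℝ) (hline 0)
  have h4 : HasDerivAt (fun t : ℝ => fderiv ℝ u (x + t • e) e)
      (fderiv ℝ (fderiv ℝ u) (x + (0 : ℝ) • e) e e) 0 :=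
    (ContinuousLinearMap.apply ℝ ℝ e).hasFDerivAt.comp_hasDerivAt (0 : ℝ) h3
  rw [h4.deriv, zero_smul, add_zero]
  rfl

/-- The Laplacian of a `C²` function is the sum of its second derivatives along the lines spanned
by the vectors of an orthonormal basis. -/
theorem ContDiffAt.laplacian_eq_sum_line {E ι : Type*} [NormedAddCommGroup E]
    [InnerProductSpace ℝ E] [FiniteDimensional ℝ E] [Fintype ι] (b : OrthonormalBasis ι ℝ E)
    {u : E → ℝ} {x : E} (hu : ContDiffAt ℝ 2 u x) :
    Laplacian.laplacian u x = ∑ i, deriv (deriv fun t : ℝ => u (x + t • b i)) 0 := by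
  rw [InnerProductSpace.laplacian_eq_iteratedFDeriv_orthonormalBasis u b]
  exact Finset.sum_congr rfl fun i _ => (hu.deriv_deriv_line (b i)).symm

theorem deriv_deriv_comp_mul_left (f : ℝ → ℝ) (c : ℝ) :
    deriv (deriv fun t => f (c * t)) 0 = c ^ 2 * deriv (deriv f) 0 := by
  have h : deriv (fun t => f (c * t)) = fun t => c * deriv f (c * t) := by
    ext t; simpa using deriv_comp_mul_left c f t
  rw [h, deriv_const_mul_field]
  have := deriv_comp_mul_left c (deriv f) 0
  simp only [smul_eq_mul, mul_zero] at this
  rw [this]; ring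

/-- Rescaling an eigenfunction which vanishes on a smaller sphere. -/
theorem IsDirichletEigenpair.comp_smul {n : ℕ} {lam ρ : ℝ} {u : EuclideanSpace ℝ (Fin n) → ℝ}
    (hu : IsDirichletEigenpair n lam u) (hρ : 0 < ρ) (hρ1 : ρ < 1)
    (hzero : ∀ x, ‖x‖ = ρ → u x = 0) (h0 : u 0 ≠ 0) :
    IsDirichletEigenpair n (ρ ^ 2 * lam) (fun x => u (ρ • x)) := by
  have hmaps : ∀ x ∈ Metric.closedBall (0 : EuclideanSpace ℝ (Fin n)) 1,
      ρ • x ∈ Metric.ball (0 : EuclideanSpace ℝ (Fin n)) 1 := by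
    intro x hx
    simp only [mem_closedBall_zero_iff] at hx
    simp only [mem_ball_zero_iff, norm_smul, Real.norm_eq_abs, abs_of_pos hρ]
    nlinarith
  have hcd : ContDiffOn ℝ 2 (fun x => u (ρ • x)) (Metric.ball 0 1) :=
    hu.contDiffOn.comp (by fun_prop) fun x hx => hmaps x (Metric.ball_subset_closedBall hx)
  refine ⟨hcd, ?_, ?_, ?_, ?_⟩
  · exact hu.continuousOn.comp (by fun_prop) fun x hx =>
      Metric.ball_subset_closedBall (hmaps x hx)
  · intro x hx
    have hx' := hmaps x (Metric.ball_subset_closedBall hx)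
    have h1 := hu.equation _ hx'
    rw [(hcd.contDiffAt (Metric.isOpen_ball.mem_nhds hx)).laplacian_eq_sum_line
      (EuclideanSpace.basisFun (Fin n) ℝ)]
    rw [(hu.contDiffOn.contDiffAt (Metric.isOpen_ball.mem_nhds hx')).laplacian_eq_sum_line
      (EuclideanSpace.basisFun (Fin n) ℝ)] at h1
    have h2 : ∀ i, deriv (deriv fun t : ℝ => u (ρ • (x + t • EuclideanSpace.basisFun (Fin n) ℝ i))) 0
        = ρ ^ 2 * deriv (deriv fun t : ℝ => u (ρ • x + t • EuclideanSpace.basisFun (Fin n) ℝ i)) 0 := by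
      intro i
      rw [← deriv_deriv_comp_mul_left]
      simp only [smul_add, smul_smul]
    simp only [h2, ← Finset.mul_sum]
    linear_combination ρ ^ 2 * h1
  · intro x hx
    apply hzero
    simp only [mem_sphere_zero_iff_norm] at hx
    simp [norm_smul, hx, abs_of_pos hρ]
  · exact ⟨0, by simp, by simpa using h0⟩

/-! ### The radial equation: positivity, uniqueness, absence of interior zeros -/

/-- `f` solves `f'' + (n-1)/r f' + lam f = 0` on `(0, 1)`, is continuous on `[0, 1]`, and its
derivative `f'` extends continuously to `0` with value `0`. -/
structure IsRegularRadialSolution (n : ℕ) (lam : ℝ) (f f' : ℝ → ℝ) : Prop where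
  continuousOn : ContinuousOn f (Icc 0 1)
  continuousOn_deriv : ContinuousOn f' (Ico 0 1)
  deriv_zero : f' 0 = 0
  hasDerivAt : ∀ r ∈ Ioo (0 : ℝ) 1, HasDerivAt f (f' r) r
  hasDerivAt_deriv : ∀ r ∈ Ioo (0 : ℝ) 1,
    HasDerivAt f' (-((n : ℝ) - 1) / r * f' r - lam * f r) r

theorem ContDiffAt.deriv_of_two {f : ℝ → ℝ} {r : ℝ} (hf : ContDiffAt ℝ 2 f r) :
    ContDiffAt ℝ 1 (deriv f) r :=
  (hf.fderiv_right (m := 1) (by norm_num)).clm_apply contDiffAt_const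

theorem norm_smul_basisFun_add {n : ℕ} (i j : Fin n) (hij : j ≠ i) (r t : ℝ) :
    ‖r • EuclideanSpace.basisFun (Fin n) ℝ i + t • EuclideanSpace.basisFun (Fin n) ℝ j‖
      = Real.sqrt (r ^ 2 + t ^ 2) := by
  have h := norm_add_sq_eq_norm_sq_add_norm_sq_of_inner_eq_zero (𝕜 := ℝ)
    (r • EuclideanSpace.basisFun (Fin n) ℝ i) (t • EuclideanSpace.basisFun (Fin n) ℝ j) (by
      rw [inner_smul_left, inner_smul_right,
        (EuclideanSpace.basisFun (Fin n) ℝ).orthonormal.2 hij.symm]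
      simp)
  rw [← Real.sqrt_mul_self (norm_nonneg _), h]
  simp [norm_smul, pow_two]

/-- The second derivative at `0` of a radial profile along a tangential line. -/
theorem deriv_deriv_comp_sqrt {f : ℝ → ℝ} {r : ℝ} (hr : 0 < r) (hf : ContDiffAt ℝ 2 f r) :
    deriv (deriv fun t : ℝ => f (Real.sqrt (r ^ 2 + t ^ 2))) 0 = deriv f r / r := by
  have hs : ∀ t : ℝ, HasDerivAt (fun t : ℝ => Real.sqrt (r ^ 2 + t ^ 2))
      (t / Real.sqrt (r ^ 2 + t ^ 2)) t := by
    intro t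
    have h1 : HasDerivAt (fun t : ℝ => r ^ 2 + t ^ 2) (2 * t) t := by
      simpa using (hasDerivAt_pow 2 t).const_add (r ^ 2)
    have := h1.sqrt (by positivity)
    convert this using 1
    field_simp
  have hs0 : Real.sqrt (r ^ 2 + 0 ^ 2) = r := by simp [Real.sqrt_sq hr.le]
  have hc : Tendsto (fun t : ℝ => Real.sqrt (r ^ 2 + t ^ 2)) (𝓝 0) (𝓝 r) := by
    have := (hs 0).continuousAt
    rwa [ContinuousAt, hs0] at this
  have hev : ∀ᶠ y in 𝓝 r, DifferentiableAt ℝ f y := by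
    filter_upwards [hf.eventually (by simp)] with y hy using hy.differentiableAt (by simp)
  have h1 : (deriv fun t : ℝ => f (Real.sqrt (r ^ 2 + t ^ 2))) =ᶠ[𝓝 0]
      fun t => (deriv f (Real.sqrt (r ^ 2 + t ^ 2)) / Real.sqrt (r ^ 2 + t ^ 2)) * t := by
    filter_upwards [hc.eventually hev] with t ht
    have := (ht.hasDerivAt.comp t (hs t)).deriv
    simp only [Function.comp_def] at this
    rw [this]; ring
  rw [h1.deriv_eq]
  have hd : DifferentiableAt ℝ (deriv f) r :=
    hf.deriv_of_two.differentiableAt (by simp)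
  have hg : DifferentiableAt ℝ
      (fun t : ℝ => deriv f (Real.sqrt (r ^ 2 + t ^ 2)) / Real.sqrt (r ^ 2 + t ^ 2)) 0 := by
    refine DifferentiableAt.div ?_ (hs 0).differentiableAt (by rw [hs0]; exact hr.ne')
    refine DifferentiableAt.comp (g := deriv f) (0 : ℝ) ?_ (hs 0).differentiableAt
    rw [hs0]; exact hd
  have := (hg.hasDerivAt.mul (hasDerivAt_id (0 : ℝ))).deriv
  simp only [id, mul_one, mul_zero, zero_add] at this
  erw [this]
  rw [hs0]

/-- At a point `r e₀` the radial line contributes `ψ''` to the Laplacian and each of the `n - 1`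
orthogonal lines contributes `ψ'/r`. The even extension `r ↦ φ |r|` is `C²` across `0`, so its
derivative vanishes there. -/
theorem IsDirichletEigenpair.isRegularRadialSolution {n : ℕ} (hn : 1 ≤ n) {lam : ℝ} {φ : ℝ → ℝ}
    (h : IsDirichletEigenpair n lam (fun x => φ ‖x‖)) :
    IsRegularRadialSolution n lam φ (deriv fun r => φ |r|) ∧ φ 1 = 0 := by
  set b := EuclideanSpace.basisFun (Fin n) ℝ with hb
  let i₀ : Fin n := ⟨0, hn⟩
  have hnb : ∀ i, ‖b i‖ = 1 := fun i => b.orthonormal.1 i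
  have hnorm : ∀ r : ℝ, ‖r • b i₀‖ = |r| := fun r => by simp [norm_smul, hnb]
  set ψ : ℝ → ℝ := fun r => φ |r| with hψ
  have hψu : ψ = fun r : ℝ => (fun x : EuclideanSpace ℝ (Fin n) => φ ‖x‖) (r • b i₀) := by
    ext r; simp [hψ, hnorm]
  have hcd : ContDiffOn ℝ 2 ψ (Ioo (-1) 1) := by
    rw [hψu]
    refine h.contDiffOn.comp (by fun_prop) fun r hr => ?_
    simpa [hnorm, abs_lt] using hr
  have hcont : ContinuousOn ψ (Icc 0 1) := by
    rw [hψu]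
    refine h.continuousOn.comp (by fun_prop) fun r hr => ?_
    simp only [mem_closedBall_zero_iff, hnorm]
    exact abs_le.2 ⟨by linarith [hr.1], hr.2⟩
  have hcd' : ∀ r ∈ Ioo (-1 : ℝ) 1, ContDiffAt ℝ 2 ψ r := fun r hr =>
    hcd.contDiffAt (isOpen_Ioo.mem_nhds hr)
  have hcd1 : ∀ r ∈ Ioo (-1 : ℝ) 1, ContDiffAt ℝ 1 (deriv ψ) r := fun r hr =>
    (hcd' r hr).deriv_of_two
  have hφψ : ∀ r : ℝ, 0 < r → φ =ᶠ[𝓝 r] ψ := fun r hr => by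
    filter_upwards [lt_mem_nhds hr] with s hs
    simp [hψ, abs_of_pos hs]
  refine ⟨⟨?_, ?_, ?_, ?_, ?_⟩, ?_⟩
  · exact hcont.congr fun r hr => by simp [hψ, abs_of_nonneg hr.1]
  · intro r hr
    exact (hcd1 r ⟨by linarith [hr.1], hr.2⟩).continuousAt.continuousWithinAt
  · have h1 : deriv (fun r => ψ (-r)) 0 = - deriv ψ 0 := by
      simpa using deriv_comp_neg ψ 0
    have h2 : (fun r => ψ (-r)) = ψ := by ext r; simp [hψ]
    rw [h2] at h1
    linarith
  · intro r hr
    have := ((hcd' r ⟨by linarith [hr.1], hr.2⟩).differentiableAt (by simp)).hasDerivAt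
    exact this.congr_of_eventuallyEq (hφψ r hr.1)
  · intro r hr
    have hr' : r ∈ Ioo (-1 : ℝ) 1 := ⟨by linarith [hr.1], hr.2⟩
    have hd := ((hcd1 r hr').differentiableAt (by simp)).hasDerivAt
    have hx : r • b i₀ ∈ Metric.ball (0 : EuclideanSpace ℝ (Fin n)) 1 := by
      simpa [hnorm, abs_lt] using hr'
    have hφr : ContDiffAt ℝ 2 φ r := (hcd' r hr').congr_of_eventuallyEq (hφψ r hr.1)
    have heq := h.equation _ hx
    rw [(h.contDiffOn.contDiffAt (Metric.isOpen_ball.mem_nhds hx)).laplacian_eq_sum_line b] at heq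
    have hterm : ∀ i, deriv (deriv fun t : ℝ => φ ‖r • b i₀ + t • b i‖) 0
        = deriv ψ r / r + if i = i₀ then deriv (deriv ψ) r - deriv ψ r / r else 0 := by
      intro i
      by_cases hi : i = i₀
      · have h1 : (fun t : ℝ => φ ‖r • b i₀ + t • b i‖) = fun t => ψ (r + t) := by
          ext t
          rw [hi, ← add_smul]; simp [hψ, norm_smul, hnb]
        have h2 : deriv (fun t => ψ (r + t)) = fun t => deriv ψ (r + t) := by
          ext t; exact deriv_comp_const_add ψ r t
        rw [h1, h2, deriv_comp_const_add]
        simp [hi]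
      · have h1 : (fun t : ℝ => φ ‖r • b i₀ + t • b i‖)
            = fun t => φ (Real.sqrt (r ^ 2 + t ^ 2)) := by
          ext t; rw [hb, norm_smul_basisFun_add i₀ i hi]
        rw [h1, deriv_deriv_comp_sqrt hr.1 hφr, (hφψ r hr.1).deriv_eq]
        simp [hi]
    simp only [hterm, Finset.sum_add_distrib, Finset.sum_ite_eq', Finset.mem_univ, if_true,
      Finset.sum_const, Finset.card_univ, Fintype.card_fin, nsmul_eq_mul, hnorm,
      abs_of_pos hr.1] at heq
    refine (hd.congr_deriv ?_)
    linear_combination heq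
  · have := h.boundary (b i₀) (by simp [hnb])
    simpa [hnb] using this

/-- The flux `r^(n-1) f'` of a regular radial solution. -/
theorem IsRegularRadialSolution.hasDerivAt_flux {n : ℕ} (hn : 1 ≤ n) {lam : ℝ} {f f' : ℝ → ℝ}
    (h : IsRegularRadialSolution n lam f f') {r : ℝ} (hr : r ∈ Ioo (0 : ℝ) 1) :
    HasDerivAt (fun r => r ^ (n - 1) * f' r) (-lam * r ^ (n - 1) * f r) r := by
  have h1 := (hasDerivAt_pow (n - 1) r).mul (h.hasDerivAt_deriv r hr)
  refine h1.congr_deriv ?_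
  have hr0 : r ≠ 0 := hr.1.ne'
  obtain ⟨m, rfl⟩ : ∃ m, n = m + 1 := ⟨n - 1, by omega⟩
  rcases m with _ | m
  · simp
  · simp only [Nat.add_sub_cancel]
    push_cast
    field_simp
    ring

theorem IsRegularRadialSolution.continuousOn_flux {n : ℕ} {lam : ℝ} {f f' : ℝ → ℝ}
    (h : IsRegularRadialSolution n lam f f') :
    ContinuousOn (fun r => r ^ (n - 1) * f' r) (Ico 0 1) :=
  (continuous_pow _).continuousOn.mul h.continuousOn_deriv

/-- A regular radial solution which vanishes at `1` but not at `0` belongs to a positive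
eigenvalue. -/
theorem IsRegularRadialSolution.lam_pos {n : ℕ} (hn : 1 ≤ n) {lam : ℝ} {f f' : ℝ → ℝ}
    (h : IsRegularRadialSolution n lam f f') (h0 : f 0 = 1) (h1 : f 1 = 0) : 0 < lam := by
  by_contra hlam
  push Not at hlam
  -- If `lam ≤ 0`, then `r^(n-1) f f'` is nondecreasing from `0`, so `f²` is nondecreasing, which is
  -- incompatible with `f 0 = 1` and `f 1 = 0`.
  have hmono : MonotoneOn (fun r => (r ^ (n - 1) * f' r) * f r) (Ico 0 1) := by
    refine monotoneOn_of_hasDerivWithinAt_nonneg (convex_Ico 0 1)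
      (f' := fun r => (-lam * r ^ (n - 1) * f r) * f r + (r ^ (n - 1) * f' r) * f' r) ?_ ?_ ?_
    · exact h.continuousOn_flux.mul (h.continuousOn.mono Ico_subset_Icc_self)
    · intro r hr
      rw [interior_Ico] at hr
      exact ((h.hasDerivAt_flux hn hr).mul (h.hasDerivAt r hr)).hasDerivWithinAt
    · intro r hr
      rw [interior_Ico] at hr
      have hp : 0 ≤ r ^ (n - 1) := pow_nonneg hr.1.le _
      have e : (-lam * r ^ (n - 1) * f r) * f r + (r ^ (n - 1) * f' r) * f' r
        = r ^ (n - 1) * (-lam * (f r) ^ 2 + f' r ^ 2) := by ring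
      rw [e]
      have : 0 ≤ -lam := by linarith
      positivity
  have hmono2 : MonotoneOn (fun r => f r ^ 2) (Icc 0 1) := by
    refine monotoneOn_of_hasDerivWithinAt_nonneg (convex_Icc 0 1)
      (f' := fun r => 2 * f r * f' r) ?_ ?_ ?_
    · exact h.continuousOn.pow 2
    · intro r hr
      rw [interior_Icc] at hr
      exact (((h.hasDerivAt r hr).pow 2).congr_deriv (by simp)).hasDerivWithinAt
    · intro r hr
      rw [interior_Icc] at hr
      have := hmono ⟨le_rfl, one_pos⟩ ⟨hr.1.le, hr.2⟩ hr.1.le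
      simp only [h.deriv_zero, mul_zero, zero_mul] at this
      have hp : 0 < r ^ (n - 1) := pow_pos hr.1 _
      have e : r ^ (n - 1) * f' r * f r = r ^ (n - 1) * (f' r * f r) := by ring
      rw [e] at this
      have := nonneg_of_mul_nonneg_right this hp
      linarith
  have := hmono2 ⟨le_rfl, zero_le_one⟩ ⟨zero_le_one, le_rfl⟩ zero_le_one
  simp only [h0, h1] at this
  norm_num at this

/-- Regular radial solutions are determined by their value at `0`. -/
theorem IsRegularRadialSolution.eqOn {n : ℕ} (hn : 1 ≤ n) {lam : ℝ} (hlam : 0 < lam)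
    {f f' g g' : ℝ → ℝ} (hf : IsRegularRadialSolution n lam f f')
    (hg : IsRegularRadialSolution n lam g g') (h0 : f 0 = g 0) : EqOn f g (Icc 0 1) := by
  -- The energy of the difference is dissipated by the first-order term, whose singular coefficient
  -- at `0` has the favourable sign, and it starts from zero.
  have hE : AntitoneOn (fun r => (f' r - g' r) ^ 2 + lam * (f r - g r) ^ 2) (Ico 0 1) := by
    refine antitoneOn_of_hasDerivWithinAt_nonpos (convex_Ico 0 1)
      (f' := fun r => -(2 * ((n : ℝ) - 1) / r * (f' r - g' r) ^ 2)) ?_ ?_ ?_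
    · exact ((hf.continuousOn_deriv.sub hg.continuousOn_deriv).pow 2).add
        (((hf.continuousOn.sub hg.continuousOn).mono Ico_subset_Icc_self).pow 2 |>.const_smul lam)
    · intro r hr
      rw [interior_Ico] at hr
      have h1 := (((hf.hasDerivAt_deriv r hr).sub (hg.hasDerivAt_deriv r hr)).pow 2).add
        ((((hf.hasDerivAt r hr).sub (hg.hasDerivAt r hr)).pow 2).const_mul lam)
      refine (h1.congr_deriv ?_).hasDerivWithinAt
      have := hr.1.ne'
      simp only [Pi.sub_apply]
      push_cast
      field_simp
      ring
    · intro r hr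
      rw [interior_Ico] at hr
      have := hr.1
      have h1 : (0 : ℝ) ≤ (n : ℝ) - 1 := by
        have : (1 : ℝ) ≤ n := by exact_mod_cast hn
        linarith
      simp only [Left.neg_nonpos_iff]
      positivity
  have hIco : EqOn f g (Ico 0 1) := by
    intro r hr
    have := hE ⟨le_rfl, one_pos⟩ hr hr.1
    simp only [hf.deriv_zero, hg.deriv_zero, h0, sub_self] at this
    have h2 : lam * (f r - g r) ^ 2 ≤ 0 := by nlinarith [sq_nonneg (f' r - g' r)]
    have h3 : (f r - g r) ^ 2 = 0 := by
      have := sq_nonneg (f r - g r)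
      nlinarith
    have := pow_eq_zero_iff (two_ne_zero) |>.1 h3
    linarith
  have hcl : Icc (0 : ℝ) 1 ⊆ closure (Ico 0 1) := by rw [closure_Ico (by norm_num)]
  exact hIco.of_subset_closure hf.continuousOn hg.continuousOn Ico_subset_Icc_self hcl

/-- The principal radial profile does not vanish inside the ball. -/
theorem IsPrincipalRadialProfile.pos {n : ℕ} (hn : 1 ≤ n) {lam : ℝ} {φ : ℝ → ℝ}
    (h : IsPrincipalRadialProfile n lam φ) : ∀ r ∈ Ico (0 : ℝ) 1, 0 < φ r := by
  obtain ⟨hs, hs1⟩ := h.1.toIsDirichletEigenpair.isRegularRadialSolution hn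
  have hlam := hs.lam_pos hn h.2 hs1
  have hne : ∀ r ∈ Ioo (0 : ℝ) 1, φ r ≠ 0 := by
    intro ρ hρ h0
    -- A zero at radius `ρ < 1` would make `x ↦ u (ρ x)` an eigenfunction for `ρ² lam < lam`.
    have := h.1.least _ _ (h.1.toIsDirichletEigenpair.comp_smul hρ.1 hρ.2
      (fun x hx => by simp only [hx, h0]) (by simp [h.2]))
    have h2 : ρ ^ 2 < 1 := by nlinarith [hρ.1, hρ.2]
    nlinarith
  intro r hr
  by_contra hneg
  push Not at hneg
  have hiv := intermediate_value_Icc' hr.1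
    (hs.continuousOn.mono (Icc_subset_Icc_right hr.2.le))
  obtain ⟨s, hs', hs0⟩ := hiv ⟨hneg, by rw [h.2]; norm_num⟩
  have hs_pos : 0 < s := by
    rcases hs'.1.eq_or_lt with h' | h'
    · rw [← h', h.2] at hs0; norm_num at hs0
    · exact h'
  exact hne s ⟨hs_pos, hs'.2.trans_lt hr.2⟩ hs0

/-! ### Everywhere convergent power series and the analytic radial solution -/

/-- The factor `k + 1` is absorbed by `2^(k+1)`, that is, by doubling `R`. Quantifying over all `R`
lets the condition pass to the coefficients of every derivative. -/
theorem summable_deriv_coeff {c : ℕ → ℝ} (hc : ∀ R : ℝ, 1 ≤ R → Summable fun k => |c k| * R ^ k)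
    (R : ℝ) (hR : 1 ≤ R) : Summable fun k : ℕ => |((k : ℝ) + 1) * c (k + 1)| * R ^ k := by
  have h := (summable_nat_add_iff 1).2 (hc (2 * R) (by linarith))
  refine Summable.of_nonneg_of_le (fun k => by positivity) (fun k => ?_) h
  rw [abs_mul, mul_pow, abs_of_nonneg (by positivity : (0 : ℝ) ≤ (k : ℝ) + 1)]
  have h1 : ((k : ℝ) + 1) ≤ 2 ^ (k + 1) := by exact_mod_cast (Nat.lt_two_pow_self (n := k + 1)).le
  have h2 : R ^ k ≤ R ^ (k + 1) := pow_le_pow_right₀ hR (Nat.le_succ k)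
  calc ((k : ℝ) + 1) * |c (k + 1)| * R ^ k = |c (k + 1)| * (((k : ℝ) + 1) * R ^ k) := by ring
    _ ≤ |c (k + 1)| * (2 ^ (k + 1) * R ^ (k + 1)) := by gcongr

/-- Termwise differentiation of an everywhere convergent power series. -/
theorem hasDerivAt_tsum_pow {c : ℕ → ℝ} (hc : ∀ R : ℝ, 1 ≤ R → Summable fun k => |c k| * R ^ k)
    (x : ℝ) : HasDerivAt (fun x => ∑' k, c k * x ^ k) (∑' k : ℕ, (((k : ℝ) + 1) * c (k + 1)) * x ^ k) x := by
  set R : ℝ := |x| + 1 with hR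
  have hR1 : 1 ≤ R := by rw [hR]; linarith [abs_nonneg x]
  have hu := hc (2 * R) (by linarith)
  have hbound : ∀ (k : ℕ) (y : ℝ), y ∈ Metric.ball (0 : ℝ) R →
      ‖c k * ((k : ℝ) * y ^ (k - 1))‖ ≤ |c k| * (2 * R) ^ k := by
    intro k y hy
    rw [mem_ball_zero_iff, Real.norm_eq_abs] at hy
    rw [Real.norm_eq_abs, abs_mul, abs_mul, mul_pow, abs_pow, Nat.abs_cast]
    have h1 : (k : ℝ) ≤ 2 ^ k := by exact_mod_cast (Nat.lt_two_pow_self (n := k)).le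
    have h2 : |y| ^ (k - 1) ≤ R ^ k :=
      (pow_le_pow_left₀ (abs_nonneg y) hy.le _).trans (pow_le_pow_right₀ hR1 (Nat.sub_le k 1))
    gcongr
  have h := hasDerivAt_tsum_of_isPreconnected (y₀ := (0 : ℝ)) (y := x) hu Metric.isOpen_ball
    (convex_ball (0 : ℝ) R).isPreconnected
    (fun k y _ => (hasDerivAt_pow k y).const_mul (c k)) hbound
    (Metric.mem_ball_self (by linarith))
    (summable_of_ne_finset_zero (s := {0}) fun k hk => by
      simp only [Finset.mem_singleton] at hk; simp [hk])
    (by rw [mem_ball_zero_iff, Real.norm_eq_abs, hR]; linarith)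
  refine h.congr_deriv ?_
  have hs : Summable fun k : ℕ => c k * ((k : ℝ) * x ^ (k - 1)) :=
    Summable.of_norm_bounded hu fun k => hbound k x
      (by rw [mem_ball_zero_iff, Real.norm_eq_abs, hR]; linarith)
  rw [hs.tsum_eq_zero_add]
  simp only [Nat.cast_zero, zero_mul, mul_zero, zero_add, Nat.add_sub_cancel]
  refine tsum_congr fun k => ?_
  push_cast; ring

theorem summable_coeff_mul_pow {c : ℕ → ℝ}
    (hc : ∀ R : ℝ, 1 ≤ R → Summable fun k => |c k| * R ^ k) (x : ℝ) :
    Summable fun k => c k * x ^ k := by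
  refine Summable.of_norm_bounded (hc (|x| + 1) (by linarith [abs_nonneg x])) fun k => ?_
  rw [Real.norm_eq_abs, abs_mul, abs_pow]
  gcongr
  linarith

theorem analyticAt_tsum_pow {c : ℕ → ℝ} (hc : ∀ R : ℝ, 1 ≤ R → Summable fun k => |c k| * R ^ k)
    (x : ℝ) : AnalyticAt ℝ (fun x => ∑' k, c k * x ^ k) x := by
  set p := FormalMultilinearSeries.ofScalars ℝ c with hp
  have hrad : p.radius = ⊤ := by
    refine FormalMultilinearSeries.radius_eq_top_of_summable_norm _ fun r => ?_
    refine Summable.of_nonneg_of_le (fun k => by positivity) (fun k => ?_)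
      (hc (r + 1) (by linarith [r.coe_nonneg]))
    rw [hp, FormalMultilinearSeries.ofScalars_norm, Real.norm_eq_abs]
    have := r.coe_nonneg
    gcongr
    linarith
  have h := p.hasFPowerSeriesOnBall (by rw [hrad]; exact ENNReal.zero_lt_top)
  rw [hrad] at h
  have h2 := h.analyticAt_of_mem (y := x) (by simp)
  have e : p.sum = fun x => ∑' k, c k * x ^ k := by
    ext y
    rw [hp, ← FormalMultilinearSeries.ofScalarsSum, FormalMultilinearSeries.ofScalarsSum_eq_tsum]
    simp
  rwa [e] at h2

/-- Taylor coefficients, in the variable `t = r²`, of the regular radial solution. -/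
noncomputable def radialCoeff (n : ℕ) (lam : ℝ) : ℕ → ℝ
  | 0 => 1
  | k + 1 => -lam * radialCoeff n lam k / (((k : ℝ) + 1) * (4 * k + 2 * n))

theorem summable_radialCoeff {n : ℕ} (hn : 1 ≤ n) (lam : ℝ) (R : ℝ) (hR : 1 ≤ R) :
    Summable fun k => |radialCoeff n lam k| * R ^ k := by
  have hn' : (1 : ℝ) ≤ n := by exact_mod_cast hn
  have hb : ∀ k, |radialCoeff n lam k| ≤ |lam| ^ k / (k.factorial : ℝ) := by
    intro k
    induction k with
    | zero => simp [radialCoeff]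
    | succ k ih =>
      rw [radialCoeff, abs_div, abs_mul, abs_neg, Nat.factorial_succ, pow_succ]
      push_cast
      have h1 : (0 : ℝ) < (k : ℝ) + 1 := by positivity
      have h2 : (1 : ℝ) ≤ 4 * k + 2 * n := by
        have : (0 : ℝ) ≤ k := by positivity
        linarith
      rw [abs_of_pos (by positivity : (0 : ℝ) < ((k : ℝ) + 1) * (4 * k + 2 * n))]
      calc |lam| * |radialCoeff n lam k| / (((k : ℝ) + 1) * (4 * k + 2 * n))
          ≤ |lam| * (|lam| ^ k / (k.factorial : ℝ)) / (((k : ℝ) + 1) * 1) := by gcongr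
        _ = |lam| ^ k * |lam| / (((k : ℝ) + 1) * k.factorial) := by field_simp
  refine Summable.of_nonneg_of_le (fun k => by positivity) (fun k => ?_)
    (Real.summable_pow_div_factorial (|lam| * R))
  calc |radialCoeff n lam k| * R ^ k ≤ |lam| ^ k / (k.factorial : ℝ) * R ^ k := by
        gcongr; exact hb k
    _ = (|lam| * R) ^ k / (k.factorial : ℝ) := by rw [mul_pow]; ring

/-- The entire function `F` for which `F (r²)` is the regular radial solution. -/
theorem exists_radialSeries {n : ℕ} (hn : 1 ≤ n) (lam : ℝ) :
    ∃ F : ℝ → ℝ, (∀ t, AnalyticAt ℝ F t) ∧ F 0 = 1 ∧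
      ∀ t, 4 * t * deriv (deriv F) t + 2 * n * deriv F t + lam * F t = 0 := by
  set a := radialCoeff n lam with ha
  have hs := summable_radialCoeff hn lam
  have hs1 := summable_deriv_coeff hs
  have hs2 := summable_deriv_coeff hs1
  refine ⟨fun t => ∑' k, a k * t ^ k, analyticAt_tsum_pow hs, ?_, fun t => ?_⟩
  · beta_reduce
    rw [tsum_eq_single 0 fun k hk => by simp [hk]]
    simp [ha, radialCoeff]
  have hd1 : deriv (fun t => ∑' k, a k * t ^ k)
      = fun t => ∑' k : ℕ, (((k : ℝ) + 1) * a (k + 1)) * t ^ k :=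
    funext fun t => (hasDerivAt_tsum_pow hs t).deriv
  rw [hd1, (hasDerivAt_tsum_pow hs1 t).deriv]
  have hS : Summable fun k : ℕ => ((k : ℝ) * (((k : ℝ) + 1) * a (k + 1))) * t ^ k := by
    refine (summable_nat_add_iff 1).1 ?_
    refine ((summable_coeff_mul_pow hs2 t).mul_left t).congr fun k => ?_
    push_cast; ring
  -- The factor `t` shifts the series of `F''` back to powers `t^k`, so that the equation can be
  -- compared coefficient by coefficient.
  have e2 : t * ∑' k : ℕ, (((k : ℝ) + 1) * ((((k + 1 : ℕ) : ℝ) + 1) * a (k + 1 + 1))) * t ^ k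
      = ∑' k : ℕ, ((k : ℝ) * (((k : ℝ) + 1) * a (k + 1))) * t ^ k := by
    rw [hS.tsum_eq_zero_add, ← tsum_mul_left]
    simp only [Nat.cast_zero, zero_mul, zero_add]
    refine tsum_congr fun k => ?_
    push_cast; ring
  have hS1 := summable_coeff_mul_pow hs1 t
  have hS0 := summable_coeff_mul_pow hs t
  rw [mul_assoc 4 t, e2]
  rw [← tsum_mul_left, ← tsum_mul_left, ← tsum_mul_left,
    ← (hS.mul_left 4).tsum_add (hS1.mul_left _),
    ← ((hS.mul_left 4).add (hS1.mul_left _)).tsum_add (hS0.mul_left _)]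
  rw [← tsum_zero (α := ℝ) (β := ℕ)]
  refine tsum_congr fun k => ?_
  have h1 : (0 : ℝ) < ((k : ℝ) + 1) * (4 * k + 2 * n) := by
    have : (1 : ℝ) ≤ n := by exact_mod_cast hn
    positivity
  have h2 : a (k + 1) * (((k : ℝ) + 1) * (4 * k + 2 * n)) = -lam * a k := by
    rw [ha, radialCoeff]; exact div_mul_cancel₀ _ h1.ne'
  linear_combination t ^ k * h2

/-! ### The principal profile in the variable `t = r²` -/

/-- `F` is the principal radial profile in the variable `t = r²`, as a real analytic function. -/
structure IsPrincipalRadialSeries (n : ℕ) (lam : ℝ) (F : ℝ → ℝ) : Prop where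
  one_le : 1 ≤ n
  lam_pos : 0 < lam
  analyticAt : ∀ t, AnalyticAt ℝ F t
  zero : F 0 = 1
  one : F 1 = 0
  pos : ∀ t ∈ Ico (0 : ℝ) 1, 0 < F t
  ode : ∀ t, 4 * t * deriv (deriv F) t + 2 * n * deriv F t + lam * F t = 0

theorem HasDerivAt.comp_sq {f : ℝ → ℝ} {f' r : ℝ} (h : HasDerivAt f f' (r ^ 2)) :
    HasDerivAt (fun r => f (r ^ 2)) (2 * r * f') r :=
  (HasDerivAt.comp (h := fun r : ℝ => r ^ 2) r h (hasDerivAt_pow 2 r)).congr_deriv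
    (by push_cast; ring)

theorem isRegularRadialSolution_of_ode {n : ℕ} {lam : ℝ} {F : ℝ → ℝ}
    (hF : ∀ t, AnalyticAt ℝ F t)
    (hode : ∀ t, 4 * t * deriv (deriv F) t + 2 * n * deriv F t + lam * F t = 0) :
    IsRegularRadialSolution n lam (fun r => F (r ^ 2)) (fun r => 2 * r * deriv F (r ^ 2)) := by
  have h1 : ∀ r : ℝ, HasDerivAt (fun r => F (r ^ 2)) (2 * r * deriv F (r ^ 2)) r := fun r =>
    (hF (r ^ 2)).differentiableAt.hasDerivAt.comp_sq
  have h2 : ∀ r : ℝ, HasDerivAt (fun r => deriv F (r ^ 2)) (2 * r * deriv (deriv F) (r ^ 2)) r :=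
    fun r => (hF (r ^ 2)).deriv.differentiableAt.hasDerivAt.comp_sq
  have h3 : ∀ r : ℝ, HasDerivAt (fun r => 2 * r * deriv F (r ^ 2))
      (2 * deriv F (r ^ 2) + 2 * r * (2 * r * deriv (deriv F) (r ^ 2))) r := fun r =>
    (((hasDerivAt_id r).const_mul 2).mul (h2 r)).congr_deriv (by simp)
  refine ⟨fun r _ => (h1 r).continuousAt.continuousWithinAt,
    fun r _ => (h3 r).continuousAt.continuousWithinAt, by simp, fun r _ => h1 r, fun r hr => ?_⟩
  refine (h3 r).congr_deriv ?_
  have := hr.1.ne'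
  field_simp
  linear_combination hode (r ^ 2)

/-- By uniqueness the profile is the power series solution. This supplies analyticity up to the
boundary `r = 1`, where an eigenfunction is only assumed continuous. -/
theorem IsPrincipalRadialProfile.exists_series {n : ℕ} (hn : 1 ≤ n) {lam : ℝ} {φ : ℝ → ℝ}
    (h : IsPrincipalRadialProfile n lam φ) :
    ∃ F, IsPrincipalRadialSeries n lam F ∧ ∀ r ∈ Icc (0 : ℝ) 1, φ r = F (r ^ 2) := by
  obtain ⟨hs, hs1⟩ := h.1.toIsDirichletEigenpair.isRegularRadialSolution hn
  have hlam := hs.lam_pos hn h.2 hs1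
  obtain ⟨F, hF, hF0, hode⟩ := exists_radialSeries hn lam
  have heq : ∀ r ∈ Icc (0 : ℝ) 1, φ r = F (r ^ 2) :=
    hs.eqOn hn hlam (isRegularRadialSolution_of_ode hF hode) (by simp [h.2, hF0])
  refine ⟨F, ⟨hn, hlam, hF, hF0, ?_, fun t ht => ?_, hode⟩, heq⟩
  · have := heq 1 ⟨zero_le_one, le_rfl⟩
    rw [hs1] at this
    simpa using this.symm
  · have h1 : Real.sqrt t ∈ Ico (0 : ℝ) 1 :=
      ⟨Real.sqrt_nonneg t, by rw [Real.sqrt_lt' one_pos]; simpa using ht.2⟩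
    have := heq _ ⟨h1.1, h1.2.le⟩
    rw [Real.sq_sqrt ht.1] at this
    rw [← this]
    exact h.pos hn _ h1

namespace IsPrincipalRadialSeries

variable {n : ℕ} {lam : ℝ} {F : ℝ → ℝ}

theorem one_le_cast (h : IsPrincipalRadialSeries n lam F) : (1 : ℝ) ≤ n := by
  exact_mod_cast h.one_le

theorem isRegularRadialSolution (h : IsPrincipalRadialSeries n lam F) :
    IsRegularRadialSolution n lam (fun r => F (r ^ 2)) (fun r => 2 * r * deriv F (r ^ 2)) :=
  isRegularRadialSolution_of_ode h.analyticAt h.ode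

theorem hasDerivAt (h : IsPrincipalRadialSeries n lam F) (t : ℝ) : HasDerivAt F (deriv F t) t :=
  (h.analyticAt t).differentiableAt.hasDerivAt

theorem deriv_zero (h : IsPrincipalRadialSeries n lam F) : deriv F 0 = -lam / (2 * n) := by
  have h1 := h.ode 0
  have h2 := h.one_le_cast
  rw [h.zero] at h1
  field_simp
  linarith

/-- The flux `r^(n-1) φ'` starts from `0` and has derivative `-lam r^(n-1) φ < 0`. At `t = 0` the
factor `2r` hides the sign of `F'`, so its explicit value is used there. -/
theorem deriv_neg (h : IsPrincipalRadialSeries n lam F) : ∀ t ∈ Icc (0 : ℝ) 1, deriv F t < 0 := by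
  have hlam := h.lam_pos
  have hsol := h.isRegularRadialSolution
  have hdF : Continuous (deriv F) :=
    continuous_iff_continuousAt.2 fun t => (h.analyticAt t).deriv.continuousAt
  have hanti : StrictAntiOn (fun r => r ^ (n - 1) * (2 * r * deriv F (r ^ 2))) (Icc 0 1) := by
    refine strictAntiOn_of_deriv_neg (convex_Icc 0 1) (by fun_prop) fun r hr => ?_
    rw [interior_Icc] at hr
    rw [(hsol.hasDerivAt_flux h.one_le hr).deriv]
    have h1 : 0 < r ^ (n - 1) := pow_pos hr.1 _
    have h2 := h.pos (r ^ 2) ⟨sq_nonneg r, by nlinarith [hr.1, hr.2]⟩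
    have : 0 < lam * r ^ (n - 1) * F (r ^ 2) := by positivity
    linarith
  intro t ht
  rcases ht.1.eq_or_lt with h0 | h0
  · rw [← h0, h.deriv_zero]
    have := h.one_le_cast
    exact div_neg_of_neg_of_pos (by linarith) (by linarith)
  · have hs : 0 < Real.sqrt t := Real.sqrt_pos.2 h0
    have := hanti ⟨le_rfl, zero_le_one⟩ ⟨hs.le, Real.sqrt_le_one.2 ht.2⟩ hs
    simp only [mul_zero, zero_mul, Real.sq_sqrt ht.1] at this
    by_contra hneg
    push Not at hneg
    have : 0 ≤ Real.sqrt t ^ (n - 1) * (2 * Real.sqrt t * deriv F t) := by positivity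
    linarith

theorem strictAntiOn (h : IsPrincipalRadialSeries n lam F) : StrictAntiOn F (Icc 0 1) := by
  refine strictAntiOn_of_deriv_neg (convex_Icc 0 1)
    (fun t _ => (h.analyticAt t).continuousAt.continuousWithinAt) fun t ht => ?_
  rw [interior_Icc] at ht
  exact h.deriv_neg t ⟨ht.1.le, ht.2.le⟩

theorem le_one (h : IsPrincipalRadialSeries n lam F) {t : ℝ} (ht : t ∈ Icc (0 : ℝ) 1) :
    F t ≤ 1 := by
  rw [← h.zero]
  exact h.strictAntiOn.antitoneOn ⟨le_rfl, zero_le_one⟩ ht ht.1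

/-- From `φ ≤ 1` the flux is at least `-(lam/n) r^n`. Integrating once more, `φ(r) ≥ 1 - lam
r²/(2n)`, and `φ(1) = 0` gives the bound. -/
theorem two_mul_le_lam (h : IsPrincipalRadialSeries n lam F) : 2 * (n : ℝ) ≤ lam := by
  have hlam := h.lam_pos
  have hsol := h.isRegularRadialSolution
  have hn := h.one_le_cast
  have hn0 : (n : ℝ) ≠ 0 := by linarith
  have hdF : Continuous (deriv F) :=
    continuous_iff_continuousAt.2 fun t => (h.analyticAt t).deriv.continuousAt
  have hF : Continuous F := continuous_iff_continuousAt.2 fun t => (h.analyticAt t).continuousAt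
  have hmono : MonotoneOn (fun r => r ^ (n - 1) * (2 * r * deriv F (r ^ 2)) + lam / n * r ^ n)
      (Icc 0 1) := by
    refine monotoneOn_of_hasDerivWithinAt_nonneg (convex_Icc 0 1)
      (f' := fun r => -lam * r ^ (n - 1) * F (r ^ 2) + lam / n * (n * r ^ (n - 1)))
      (by fun_prop) (fun r hr => ?_) fun r hr => ?_
    · rw [interior_Icc] at hr
      exact ((hsol.hasDerivAt_flux h.one_le hr).add
        ((hasDerivAt_pow n r).const_mul _)).hasDerivWithinAt
    · rw [interior_Icc] at hr
      have h1 : 0 < r ^ (n - 1) := pow_pos hr.1 _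
      have h2 := h.le_one (t := r ^ 2) ⟨sq_nonneg r, by nlinarith [hr.1, hr.2]⟩
      have e : -lam * r ^ (n - 1) * F (r ^ 2) + lam / n * (n * r ^ (n - 1))
        = lam * r ^ (n - 1) * (1 - F (r ^ 2)) := by field_simp; ring
      rw [e]
      have : 0 ≤ 1 - F (r ^ 2) := by linarith
      positivity
  have hmono2 : MonotoneOn (fun r => F (r ^ 2) + lam / (2 * n) * r ^ 2) (Icc 0 1) := by
    refine monotoneOn_of_hasDerivWithinAt_nonneg (convex_Icc 0 1)
      (f' := fun r => 2 * r * deriv F (r ^ 2) + lam / (2 * n) * (2 * r))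
      (by fun_prop) (fun r hr => ?_) fun r hr => ?_
    · rw [interior_Icc] at hr
      exact ((hsol.hasDerivAt r hr).add
        (((hasDerivAt_pow 2 r).congr_deriv (by simp)).const_mul _)).hasDerivWithinAt
    · rw [interior_Icc] at hr
      have h1 : 0 < r ^ (n - 1) := pow_pos hr.1 _
      have h2 := hmono ⟨le_rfl, zero_le_one⟩ ⟨hr.1.le, hr.2.le⟩ hr.1.le
      simp only [mul_zero, zero_mul, zero_pow (by have := h.one_le; omega : n ≠ 0), add_zero] at h2
      have e : r ^ n = r ^ (n - 1) * r := by
        rw [← pow_succ, Nat.sub_add_cancel h.one_le]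
      rw [e] at h2
      have e2 : r ^ (n - 1) * (2 * r * deriv F (r ^ 2)) + lam / n * (r ^ (n - 1) * r)
        = r ^ (n - 1) * (2 * r * deriv F (r ^ 2) + lam / (2 * n) * (2 * r)) := by
        field_simp
      rw [e2] at h2
      exact nonneg_of_mul_nonneg_right h2 h1
  have := hmono2 ⟨le_rfl, zero_le_one⟩ ⟨zero_le_one, le_rfl⟩ zero_le_one
  simp only [one_pow, h.one, zero_pow (two_ne_zero), h.zero, mul_zero, add_zero, mul_one,
    zero_add] at this
  rw [le_div_iff₀ (by linarith)] at this
  linarith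

/-- The energy `φ'² + lam φ²` is nonincreasing; it equals `lam` at the origin and `φ'(1)²` at the
boundary. -/
theorem sq_deriv_one_le (h : IsPrincipalRadialSeries n lam F) : (2 * deriv F 1) ^ 2 ≤ lam := by
  have hsol := h.isRegularRadialSolution
  have hdF : Continuous (deriv F) :=
    continuous_iff_continuousAt.2 fun t => (h.analyticAt t).deriv.continuousAt
  have hF : Continuous F := continuous_iff_continuousAt.2 fun t => (h.analyticAt t).continuousAt
  have hE : AntitoneOn (fun r => (2 * r * deriv F (r ^ 2)) ^ 2 + lam * (F (r ^ 2)) ^ 2)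
      (Icc 0 1) := by
    refine antitoneOn_of_hasDerivWithinAt_nonpos (convex_Icc 0 1)
      (f' := fun r => -(2 * ((n : ℝ) - 1) / r * (2 * r * deriv F (r ^ 2)) ^ 2))
      (by fun_prop) (fun r hr => ?_) fun r hr => ?_
    · rw [interior_Icc] at hr
      have h1 := ((hsol.hasDerivAt_deriv r hr).pow 2).add
        (((hsol.hasDerivAt r hr).pow 2).const_mul lam)
      refine (h1.congr_deriv ?_).hasDerivWithinAt
      have := hr.1.ne'
      push_cast
      field_simp
      ring
    · rw [interior_Icc] at hr
      have := hr.1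
      have h1 : (0 : ℝ) ≤ (n : ℝ) - 1 := by linarith [h.one_le_cast]
      simp only [Left.neg_nonpos_iff]
      positivity
  have := hE ⟨le_rfl, zero_le_one⟩ ⟨zero_le_one, le_rfl⟩ zero_le_one
  simpa [h.zero, h.one] using this

theorem derivWithin_eq (h : IsPrincipalRadialSeries n lam F) {φ : ℝ → ℝ}
    (hφ : ∀ r ∈ Icc (0 : ℝ) 1, φ r = F (r ^ 2)) :
    derivWithin φ (Icc 0 1) 1 = 2 * deriv F 1 := by
  have h1 : HasDerivAt (fun r => F (r ^ 2)) (2 * deriv F 1) 1 := by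
    have h2 : HasDerivAt F (deriv F 1) ((1 : ℝ) ^ 2) := by simpa using h.hasDerivAt 1
    exact h2.comp_sq.congr_deriv (by ring)
  rw [derivWithin_congr (f := fun r => F (r ^ 2)) hφ (hφ 1 ⟨zero_le_one, le_rfl⟩)]
  exact h1.hasDerivWithinAt.derivWithin (uniqueDiffOn_Icc one_pos 1 ⟨zero_le_one, le_rfl⟩)

end IsPrincipalRadialSeries

/-! ### Oscillatory integrals and integration by parts -/

/-- The oscillating integral `∫₀¹ sin(ξ F(r²) + θ) G(r²) r^m dr`. -/
noncomputable def phaseIntegral (F : ℝ → ℝ) (m : ℕ) (θ : ℝ) (G : ℝ → ℝ) (ξ : ℝ) : ℝ :=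
  ∫ r in (0 : ℝ)..1, Real.sin (ξ * F (r ^ 2) + θ) * G (r ^ 2) * r ^ m

/-- The amplitude left after one integration by parts of an amplitude `G(r²) r^(k+1)`. -/
noncomputable def transportAmplitude (F : ℝ → ℝ) (k : ℕ) (G : ℝ → ℝ) (t : ℝ) : ℝ :=
  k * (G t / deriv F t) + 2 * t * deriv (fun s => G s / deriv F s) t

theorem sq_mem_Icc {r : ℝ} (hr : r ∈ Icc (0 : ℝ) 1) : r ^ 2 ∈ Icc (0 : ℝ) 1 :=
  ⟨sq_nonneg r, by nlinarith [hr.1, hr.2]⟩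

theorem AnalyticOnNhd.continuousOn_comp_sq {G : ℝ → ℝ} (hG : AnalyticOnNhd ℝ G (Icc 0 1)) :
    ContinuousOn (fun r => G (r ^ 2)) (Icc 0 1) :=
  hG.continuousOn.comp (by fun_prop) fun _ hr => sq_mem_Icc hr

theorem continuousOn_phase {F G : ℝ → ℝ} (hF : AnalyticOnNhd ℝ F (Icc 0 1))
    (hG : AnalyticOnNhd ℝ G (Icc 0 1)) (m : ℕ) (θ ξ : ℝ) :
    ContinuousOn (fun r => Real.sin (ξ * F (r ^ 2) + θ) * G (r ^ 2) * r ^ m) (Icc 0 1) := by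
  have h1 := hF.continuousOn_comp_sq
  have h2 := hG.continuousOn_comp_sq
  exact ((Real.continuous_sin.comp_continuousOn ((h1.const_smul ξ).add continuousOn_const)).mul
    h2).mul (by fun_prop)

theorem intervalIntegrable_phase {F G : ℝ → ℝ} (hF : AnalyticOnNhd ℝ F (Icc 0 1))
    (hG : AnalyticOnNhd ℝ G (Icc 0 1)) (m : ℕ) (θ ξ : ℝ) :
    IntervalIntegrable (fun r => Real.sin (ξ * F (r ^ 2) + θ) * G (r ^ 2) * r ^ m)
      MeasureTheory.volume 0 1 :=
  ContinuousOn.intervalIntegrable (by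
    rw [uIcc_of_le zero_le_one]; exact continuousOn_phase hF hG m θ ξ)

theorem phaseIntegral_isBigO_one (F : ℝ → ℝ) {G : ℝ → ℝ} (hG : AnalyticOnNhd ℝ G (Icc 0 1))
    (m : ℕ) (θ : ℝ) : phaseIntegral F m θ G =O[atTop] fun _ => (1 : ℝ) := by
  obtain ⟨C, hC⟩ := isCompact_Icc.exists_bound_of_continuousOn hG.continuousOn_comp_sq
  refine IsBigO.of_bound C (Eventually.of_forall fun ξ => ?_)
  have := intervalIntegral.norm_integral_le_of_norm_le_const (a := (0 : ℝ)) (b := 1) (C := C)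
    (f := fun r => Real.sin (ξ * F (r ^ 2) + θ) * G (r ^ 2) * r ^ m) fun r hr => by
      rw [uIoc_of_le zero_le_one] at hr
      have h1 := hC r ⟨hr.1.le, hr.2⟩
      rw [norm_mul, norm_mul]
      have h2 : ‖Real.sin (ξ * F (r ^ 2) + θ)‖ ≤ 1 := Real.abs_sin_le_one _
      have h3 : ‖r ^ m‖ ≤ 1 := by
        rw [Real.norm_eq_abs, abs_of_nonneg (pow_nonneg hr.1.le m)]
        exact pow_le_one₀ hr.1.le hr.2
      calc _ ≤ 1 * C * 1 := by
            have : 0 ≤ C := (norm_nonneg _).trans h1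
            gcongr
        _ = C := by ring
  simpa [phaseIntegral] using this

theorem AnalyticOnNhd.div_deriv {F G : ℝ → ℝ} (hF : AnalyticOnNhd ℝ F (Icc 0 1))
    (hF' : ∀ t ∈ Icc (0 : ℝ) 1, deriv F t ≠ 0) (hG : AnalyticOnNhd ℝ G (Icc 0 1)) :
    AnalyticOnNhd ℝ (fun t => G t / deriv F t) (Icc 0 1) := fun t ht =>
  (hG t ht).div (hF t ht).deriv (hF' t ht)

theorem AnalyticOnNhd.transportAmplitude {F G : ℝ → ℝ} (hF : AnalyticOnNhd ℝ F (Icc 0 1))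
    (hF' : ∀ t ∈ Icc (0 : ℝ) 1, deriv F t ≠ 0) (hG : AnalyticOnNhd ℝ G (Icc 0 1)) (k : ℕ) :
    AnalyticOnNhd ℝ (transportAmplitude F k G) (Icc 0 1) := fun t ht => by
  have hH := hF.div_deriv hF' hG t ht
  exact (analyticAt_const.mul hH).add ((analyticAt_const.mul analyticAt_id).mul hH.deriv)

/-- Integration by parts against the phase. -/
theorem phaseIntegral_succ {F G : ℝ → ℝ} (hF : AnalyticOnNhd ℝ F (Icc 0 1))
    (hF' : ∀ t ∈ Icc (0 : ℝ) 1, deriv F t ≠ 0) (hG : AnalyticOnNhd ℝ G (Icc 0 1)) (k : ℕ)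
    (θ : ℝ) {ξ : ℝ} (hξ : 0 < ξ) :
    phaseIntegral F (k + 1) θ G ξ = 1 / (2 * ξ) *
      (Real.sin (ξ * F 1 + (θ - Real.pi / 2)) * (G 1 / deriv F 1)
        - Real.sin (ξ * F 0 + (θ - Real.pi / 2)) * (G 0 / deriv F 0) * 0 ^ k
        - ∫ r in (0 : ℝ)..1, Real.sin (ξ * F (r ^ 2) + (θ - Real.pi / 2)) *
          (2 * r * deriv (fun s => G s / deriv F s) (r ^ 2) * r ^ k
            + (G (r ^ 2) / deriv F (r ^ 2)) * (k * r ^ (k - 1)))) := by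
  set H : ℝ → ℝ := fun s => G s / deriv F s with hHdef
  have hH : AnalyticOnNhd ℝ H (Icc 0 1) := hF.div_deriv hF' hG
  have hv : ∀ r ∈ uIcc (0 : ℝ) 1, HasDerivAt (fun r => H (r ^ 2) * r ^ k)
      (2 * r * deriv H (r ^ 2) * r ^ k + H (r ^ 2) * (k * r ^ (k - 1))) r := by
    intro r hr
    rw [uIcc_of_le zero_le_one] at hr
    exact ((hH _ (sq_mem_Icc hr)).differentiableAt.hasDerivAt.comp_sq).mul (hasDerivAt_pow k r)
  -- Integrating the sine lowers its phase shift by `π/2`; carrying the shift `θ` avoids alternating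
  -- between sines and cosines.
  have hu : ∀ r ∈ uIcc (0 : ℝ) 1,
      HasDerivAt (fun r => Real.sin (ξ * F (r ^ 2) + (θ - Real.pi / 2)))
      (Real.sin (ξ * F (r ^ 2) + θ) * (ξ * (2 * r * deriv F (r ^ 2)))) r := by
    intro r hr
    rw [uIcc_of_le zero_le_one] at hr
    have h1 := (((hF _ (sq_mem_Icc hr)).differentiableAt.hasDerivAt.comp_sq).const_mul ξ).add_const
      (θ - Real.pi / 2)
    refine h1.sin.congr_deriv ?_
    rw [← add_sub_assoc, Real.cos_sub_pi_div_two]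
  have hdF : AnalyticOnNhd ℝ (deriv F) (Icc 0 1) := fun t ht => (hF t ht).deriv
  have hdH : AnalyticOnNhd ℝ (deriv H) (Icc 0 1) := fun t ht => (hH t ht).deriv
  have hIcc : uIcc (0 : ℝ) 1 = Icc 0 1 := uIcc_of_le zero_le_one
  have hpar := intervalIntegral.integral_mul_deriv_eq_deriv_mul hv hu
    (ContinuousOn.intervalIntegrable (by
      rw [hIcc]
      have h1 := hdH.continuousOn_comp_sq
      have h2 := hH.continuousOn_comp_sq
      exact (((continuousOn_const.mul continuousOn_id).mul h1).mul (by fun_prop)).add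
        (h2.mul (by fun_prop))))
    (ContinuousOn.intervalIntegrable (by
      rw [hIcc]
      have h1 := hF.continuousOn_comp_sq
      have h2 := hdF.continuousOn_comp_sq
      exact (Real.continuous_sin.comp_continuousOn
        ((h1.const_smul ξ).add continuousOn_const)).mul (by fun_prop)))
  have hL : ∫ r in (0 : ℝ)..1, (H (r ^ 2) * r ^ k) *
      (Real.sin (ξ * F (r ^ 2) + θ) * (ξ * (2 * r * deriv F (r ^ 2))))
      = 2 * ξ * phaseIntegral F (k + 1) θ G ξ := by
    rw [phaseIntegral, ← intervalIntegral.integral_const_mul]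
    refine intervalIntegral.integral_congr fun r hr => ?_
    rw [hIcc] at hr
    have := hF' _ (sq_mem_Icc hr)
    simp only [hHdef]
    field_simp
    ring
  rw [hL] at hpar
  simp only [one_pow, mul_one, zero_pow (two_ne_zero)] at hpar
  have hcomm : ∫ r in (0 : ℝ)..1, Real.sin (ξ * F (r ^ 2) + (θ - Real.pi / 2)) *
          (2 * r * deriv H (r ^ 2) * r ^ k + H (r ^ 2) * (k * r ^ (k - 1)))
      = ∫ r in (0 : ℝ)..1, (2 * r * deriv H (r ^ 2) * r ^ k + H (r ^ 2) * (k * r ^ (k - 1))) *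
        Real.sin (ξ * F (r ^ 2) + (θ - Real.pi / 2)) := by
    simp only [mul_comm]
  change _ = 1 / (2 * ξ) * (_ * H 1 - _ * H 0 * 0 ^ k - ∫ r in (0 : ℝ)..1,
    Real.sin (ξ * F (r ^ 2) + (θ - Real.pi / 2)) *
          (2 * r * deriv H (r ^ 2) * r ^ k + H (r ^ 2) * (k * r ^ (k - 1))))
  rw [hcomm, one_div, eq_inv_mul_iff_mul_eq₀ (by positivity)]
  linear_combination hpar

/-- The boundary term at the origin carries `0^(k+1)` and disappears; only `r = 1` is seen. -/
theorem phaseIntegral_add_two {F G : ℝ → ℝ} (hF : AnalyticOnNhd ℝ F (Icc 0 1))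
    (hF' : ∀ t ∈ Icc (0 : ℝ) 1, deriv F t ≠ 0) (hG : AnalyticOnNhd ℝ G (Icc 0 1)) (k : ℕ)
    (θ : ℝ) {ξ : ℝ} (hξ : 0 < ξ) :
    phaseIntegral F (k + 2) θ G ξ = 1 / (2 * ξ) *
      (Real.sin (ξ * F 1 + (θ - Real.pi / 2)) * (G 1 / deriv F 1)
        - phaseIntegral F k (θ - Real.pi / 2) (transportAmplitude F (k + 1) G) ξ) := by
  rw [phaseIntegral_succ hF hF' hG (k + 1) θ hξ]
  simp only [zero_pow (Nat.succ_ne_zero k), mul_zero, sub_zero, phaseIntegral,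
    Nat.add_sub_cancel]
  congr 2
  refine intervalIntegral.integral_congr fun r _ => ?_
  simp only [transportAmplitude]
  ring

/-- With the weight `r¹` the origin does contribute, and the power of `r` no longer drops, so the
remaining integral is of the same kind. -/
theorem phaseIntegral_one {F G : ℝ → ℝ} (hF : AnalyticOnNhd ℝ F (Icc 0 1))
    (hF' : ∀ t ∈ Icc (0 : ℝ) 1, deriv F t ≠ 0) (hG : AnalyticOnNhd ℝ G (Icc 0 1))
    (θ : ℝ) {ξ : ℝ} (hξ : 0 < ξ) :
    phaseIntegral F 1 θ G ξ = 1 / (2 * ξ) *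
      (Real.sin (ξ * F 1 + (θ - Real.pi / 2)) * (G 1 / deriv F 1)
        - Real.sin (ξ * F 0 + (θ - Real.pi / 2)) * (G 0 / deriv F 0)
        - phaseIntegral F 1 (θ - Real.pi / 2)
          (fun t => 2 * deriv (fun s => G s / deriv F s) t) ξ) := by
  rw [phaseIntegral_succ hF hF' hG 0 θ hξ]
  simp only [pow_zero, mul_one, phaseIntegral]
  congr 2
  refine intervalIntegral.integral_congr fun r _ => ?_
  simp only [Nat.cast_zero, zero_mul, mul_zero, add_zero]
  ring

theorem isBigO_sin_one (f : ℝ → ℝ) (c : ℝ) :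
    (fun ξ => Real.sin (f ξ) * c) =O[atTop] fun _ => (1 : ℝ) :=
  IsBigO.of_bound |c| (Eventually.of_forall fun ξ => by
    rw [norm_mul, Real.norm_eq_abs, Real.norm_eq_abs]
    simpa using mul_le_mul_of_nonneg_right (Real.abs_sin_le_one (f ξ)) (abs_nonneg c))

theorem isBigO_inv_mul {f : ℝ → ℝ} {g : ℝ → ℝ} (hfg : ∀ ξ, 0 < ξ → f ξ = 1 / (2 * ξ) * g ξ)
    (hg : g =O[atTop] fun _ => (1 : ℝ)) : f =O[atTop] fun ξ => ξ⁻¹ := by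
  have h1 : (fun ξ : ℝ => 1 / (2 * ξ)) =O[atTop] fun ξ : ℝ => ξ⁻¹ := by
    simpa [mul_comm] using (isBigO_refl (fun ξ : ℝ => ξ⁻¹) atTop).const_mul_left (1 / 2)
  have h2 := h1.mul hg
  simp only [mul_one] at h2
  refine h2.congr' ?_ EventuallyEq.rfl
  filter_upwards [eventually_gt_atTop 0] with ξ hξ using (hfg ξ hξ).symm

theorem phaseIntegral_succ_isBigO {F G : ℝ → ℝ} (hF : AnalyticOnNhd ℝ F (Icc 0 1))
    (hF' : ∀ t ∈ Icc (0 : ℝ) 1, deriv F t ≠ 0) (hG : AnalyticOnNhd ℝ G (Icc 0 1)) (k : ℕ)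
    (θ : ℝ) : phaseIntegral F (k + 1) θ G =O[atTop] fun ξ => ξ⁻¹ := by
  rcases k with _ | k
  · refine isBigO_inv_mul (fun ξ hξ => phaseIntegral_one hF hF' hG θ hξ) ?_
    have hH : AnalyticOnNhd ℝ (fun t => 2 * deriv (fun s => G s / deriv F s) t) (Icc 0 1) :=
      fun t ht => analyticAt_const.mul (hF.div_deriv hF' hG t ht).deriv
    exact ((isBigO_sin_one _ _).sub (isBigO_sin_one _ _)).sub (phaseIntegral_isBigO_one F hH _ _)
  · refine isBigO_inv_mul (fun ξ hξ => phaseIntegral_add_two hF hF' hG k θ hξ) ?_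
    exact (isBigO_sin_one _ _).sub
      (phaseIntegral_isBigO_one F (hF.transportAmplitude hF' hG _) _ _)

/-! ### The Fresnel integral -/

/-- The tail of a complex Gaussian integral. -/
theorem norm_integral_cexp_neg_mul_sq_le {b : ℂ} (hb : 0 < b.re) {R : ℝ} (hR : 1 ≤ R) :
    ‖∫ y in (1 : ℝ)..R, Complex.exp (-b * (y : ℂ) ^ 2)‖ ≤ 1 / ‖b‖ := by
  have hb0 : b ≠ 0 := by rintro rfl; simp at hb
  have hpos : ∀ y ∈ uIcc 1 R, 0 < y := fun y hy => by
    rw [uIcc_of_le hR] at hy; linarith [hy.1]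
  have hexp : ∀ y : ℝ, ‖Complex.exp (-b * (y : ℂ) ^ 2)‖ ≤ 1 := fun y => by
    rw [Complex.norm_exp, Real.exp_le_one_iff]
    have : (-b * (y : ℂ) ^ 2).re = -(b.re * y ^ 2) := by
      rw [← Complex.ofReal_pow, Complex.re_mul_ofReal, Complex.neg_re, neg_mul]
    rw [this, Left.neg_nonpos_iff]
    positivity
  -- The integrand is its own derivative times `-1/(2by)`. The resulting bound depends on `‖b‖`
  -- alone, not on `b.re`, so it survives the limit to the imaginary axis.
  have hu : ∀ y ∈ uIcc 1 R, HasDerivAt (fun y : ℝ => -(1 / (2 * b)) * ((y⁻¹ : ℝ) : ℂ))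
      (1 / (2 * b) * (((y ^ 2)⁻¹ : ℝ) : ℂ)) y := by
    intro y hy
    have := ((hasDerivAt_inv (hpos y hy).ne').ofReal_comp).const_mul (-(1 / (2 * b)))
    refine this.congr_deriv ?_
    push_cast; ring
  have hv : ∀ y ∈ uIcc 1 R, HasDerivAt (fun y : ℝ => Complex.exp (-b * (y : ℂ) ^ 2))
      (Complex.exp (-b * (y : ℂ) ^ 2) * (-b * (2 * y))) y := by
    intro y _
    have h1 : HasDerivAt (fun y : ℝ => (y : ℂ) ^ 2) (2 * (y : ℂ)) y := by
      have := (Complex.ofRealCLM.hasDerivAt (x := y)).pow 2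
      exact this.congr_deriv (by simp)
    exact (h1.const_mul (-b)).cexp
  have hinv : ContinuousOn (fun y : ℝ => (y ^ 2)⁻¹) (uIcc 1 R) :=
    ContinuousOn.inv₀ (by fun_prop) fun y hy => (pow_pos (hpos y hy) 2).ne'
  have hpar := intervalIntegral.integral_mul_deriv_eq_deriv_mul hu hv
    (ContinuousOn.intervalIntegrable (continuousOn_const.mul
      (Complex.continuous_ofReal.comp_continuousOn hinv)))
    (Continuous.intervalIntegrable (by fun_prop) _ _)
  have hL : ∫ y in (1 : ℝ)..R, (-(1 / (2 * b)) * ((y⁻¹ : ℝ) : ℂ)) *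
      (Complex.exp (-b * (y : ℂ) ^ 2) * (-b * (2 * y)))
      = ∫ y in (1 : ℝ)..R, Complex.exp (-b * (y : ℂ) ^ 2) := by
    refine intervalIntegral.integral_congr fun y hy => ?_
    have h1 : (y : ℂ) ≠ 0 := by exact_mod_cast (hpos y hy).ne'
    simp only [Complex.ofReal_inv]
    field_simp
  rw [hL] at hpar
  rw [hpar]
  have hbn : 0 < ‖b‖ := norm_pos_iff.2 hb0
  have hR0 : 0 < R := by linarith
  have hcoef : ‖1 / (2 * b)‖ = 1 / (2 * ‖b‖) := by simp
  have h1 : ‖-(1 / (2 * b)) * ((R⁻¹ : ℝ) : ℂ) * Complex.exp (-b * (R : ℂ) ^ 2)‖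
      ≤ 1 / (2 * ‖b‖) * R⁻¹ := by
    rw [norm_mul, norm_mul, norm_neg, hcoef, Complex.norm_real, Real.norm_eq_abs,
      abs_of_pos (inv_pos.2 hR0)]
    exact mul_le_of_le_one_right (by positivity) (hexp R)
  have h2 : ‖-(1 / (2 * b)) * (((1 : ℝ)⁻¹ : ℝ) : ℂ) * Complex.exp (-b * ((1 : ℝ) : ℂ) ^ 2)‖
      ≤ 1 / (2 * ‖b‖) := by
    rw [norm_mul, norm_mul, norm_neg, hcoef]
    simpa using mul_le_of_le_one_right (by positivity : 0 ≤ 1 / (2 * ‖b‖)) (hexp 1)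
  have h3 : ‖∫ y in (1 : ℝ)..R, (1 / (2 * b) * (((y ^ 2)⁻¹ : ℝ) : ℂ)) *
      Complex.exp (-b * (y : ℂ) ^ 2)‖ ≤ 1 / (2 * ‖b‖) * (1 - R⁻¹) := by
    have hint : ∫ y in (1 : ℝ)..R, 1 / (2 * ‖b‖) * (y ^ 2)⁻¹ = 1 / (2 * ‖b‖) * (1 - R⁻¹) := by
      rw [intervalIntegral.integral_const_mul]
      congr 1
      have := intervalIntegral.integral_eq_sub_of_hasDerivAt (a := 1) (b := R)
        (f := fun y : ℝ => -y⁻¹) (f' := fun y => (y ^ 2)⁻¹)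
        (fun y hy => ((hasDerivAt_inv (hpos y hy).ne').neg).congr_deriv (by ring))
        hinv.intervalIntegrable
      rw [this]; ring
    rw [← hint]
    refine intervalIntegral.norm_integral_le_of_norm_le hR (Eventually.of_forall fun y hy => ?_)
      (continuousOn_const.mul hinv).intervalIntegrable
    rw [norm_mul, norm_mul, hcoef, Complex.norm_real, Real.norm_eq_abs,
      abs_of_nonneg (by positivity)]
    exact mul_le_of_le_one_right (by positivity) (hexp y)
  calc _ ≤ 1 / (2 * ‖b‖) * R⁻¹ + 1 / (2 * ‖b‖) + 1 / (2 * ‖b‖) * (1 - R⁻¹) :=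
        (norm_sub_le _ _).trans (add_le_add ((norm_sub_le _ _).trans (add_le_add h1 h2)) h3)
    _ = 1 / ‖b‖ := by field_simp; ring

theorem norm_integral_cexp_sub_le {b : ℂ} (hb : 0 < b.re) :
    ‖(∫ y in (0 : ℝ)..1, Complex.exp (-b * (y : ℂ) ^ 2)) - (Real.pi / b) ^ (1 / 2 : ℂ) / 2‖
      ≤ 1 / ‖b‖ := by
  have hint : MeasureTheory.Integrable fun y : ℝ => Complex.exp (-b * (y : ℂ) ^ 2) :=
    integrable_cexp_neg_mul_sq hb
  have hlim := MeasureTheory.intervalIntegral_tendsto_integral_Ioi (0 : ℝ) hint.integrableOn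
    tendsto_id
  rw [integral_gaussian_complex_Ioi hb] at hlim
  have h1 := ((tendsto_const_nhds
    (x := ∫ y in (0 : ℝ)..1, Complex.exp (-b * (y : ℂ) ^ 2))).sub hlim).norm
  refine le_of_tendsto h1 ?_
  filter_upwards [eventually_ge_atTop 1] with R hR
  rw [norm_sub_rev, id, intervalIntegral.integral_interval_sub_left hint.intervalIntegrable
    hint.intervalIntegrable]
  exact norm_integral_cexp_neg_mul_sq_le hb hR

/-- The Fresnel integral over `[0, 1]`. -/
theorem norm_fresnel_sub_le {ξ : ℝ} (hξ : 0 < ξ) :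
    ‖(∫ y in (0 : ℝ)..1, Complex.exp (-(ξ * Complex.I) * (y : ℂ) ^ 2))
      - (Real.pi / (ξ * Complex.I)) ^ (1 / 2 : ℂ) / 2‖ ≤ 1 / ξ := by
  -- The Gaussian formula needs a positive real part, so `b = ε + iξ` is used and `ε → 0⁺`; the
  -- square root is continuous at the limit because `π/(iξ)` avoids the branch cut.
  have hb : Tendsto (fun ε : ℝ => (ε : ℂ) + ξ * Complex.I) (𝓝[>] 0) (𝓝 (ξ * Complex.I)) := by
    have : Continuous fun ε : ℝ => (ε : ℂ) + ξ * Complex.I := by fun_prop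
    have := this.tendsto 0
    simp only [Complex.ofReal_zero, zero_add] at this
    exact this.mono_left nhdsWithin_le_nhds
  have hc : Continuous fun b : ℂ => ∫ y in (0 : ℝ)..1, Complex.exp (-b * (y : ℂ) ^ 2) :=
    intervalIntegral.continuous_parametric_intervalIntegral_of_continuous' (by fun_prop) 0 1
  have hne : (ξ * Complex.I : ℂ) ≠ 0 := by simp [hξ.ne']
  have hslit : (Real.pi / (ξ * Complex.I) : ℂ) ∈ Complex.slitPlane := by
    rw [Complex.mem_slitPlane_iff]
    right
    have : (Real.pi / (ξ * Complex.I) : ℂ) = ((-(Real.pi / ξ) : ℝ) : ℂ) * Complex.I := by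
      have : (ξ : ℂ) ≠ 0 := by exact_mod_cast hξ.ne'
      push_cast
      field_simp
      simp
    rw [this]
    simp [Real.pi_ne_zero, hξ.ne']
  have hp : ContinuousAt (fun b : ℂ => (Real.pi / b : ℂ) ^ (1 / 2 : ℂ) / 2) (ξ * Complex.I) :=
    ((continuousAt_const.div continuousAt_id hne).cpow continuousAt_const hslit).div_const 2
  have hlim := (((hc.tendsto _).comp hb).sub (hp.tendsto.comp hb)).norm
  have hlim2 : Tendsto (fun ε : ℝ => 1 / ‖(ε : ℂ) + ξ * Complex.I‖) (𝓝[>] 0)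
      (𝓝 (1 / ‖(ξ * Complex.I : ℂ)‖)) :=
    tendsto_const_nhds.div hb.norm (norm_ne_zero_iff.2 hne)
  have hn : ‖(ξ * Complex.I : ℂ)‖ = ξ := by simp [abs_of_pos hξ]
  rw [hn] at hlim2
  refine le_of_tendsto_of_tendsto hlim hlim2 ?_
  filter_upwards [self_mem_nhdsWithin] with ε hε
  exact norm_integral_cexp_sub_le (b := (ε : ℂ) + ξ * Complex.I) (by simpa using hε)

theorem cpow_half_pi_div {ξ : ℝ} (hξ : 0 < ξ) :
    (Real.pi / (ξ * Complex.I) : ℂ) ^ (1 / 2 : ℂ)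
      = Real.sqrt (Real.pi / ξ) * Complex.exp (-(Real.pi / 4) * Complex.I) := by
  have hpos : 0 < Real.pi / ξ := div_pos Real.pi_pos hξ
  have h1 : (Real.pi / (ξ * Complex.I) : ℂ) = ((Real.pi / ξ : ℝ) : ℂ) * -Complex.I := by
    have : (ξ : ℂ) ≠ 0 := by exact_mod_cast hξ.ne'
    push_cast
    field_simp
    simp
  have hne : ((Real.pi / ξ : ℝ) : ℂ) ≠ 0 := by exact_mod_cast hpos.ne'
  have hsq : ((Real.sqrt (Real.pi / ξ) : ℝ) : ℂ)
      = Complex.exp (((Real.log (Real.pi / ξ) : ℝ) : ℂ) * (1 / 2)) := by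
    rw [Real.sqrt_eq_rpow, Real.rpow_def_of_pos hpos]
    push_cast
    rfl
  rw [h1, Complex.cpow_def_of_ne_zero (mul_ne_zero hne (by simp)),
    Complex.log_ofReal_mul hpos (by simp), Complex.log_neg_I, hsq, ← Complex.exp_add]
  congr 1
  ring

/-- The integrand is the imaginary part of `e^{i(ξ+θ)} e^{-iξy²}`; the `-π/4` is the argument of the
principal square root of `1/i`. -/
theorem abs_integral_sin_sub_le {ξ : ℝ} (hξ : 0 < ξ) (θ : ℝ) :
    |(∫ y in (0 : ℝ)..1, Real.sin (ξ * (1 - y ^ 2) + θ))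
      - Real.sqrt (Real.pi / ξ) / 2 * Real.sin (ξ + θ - Real.pi / 4)| ≤ 1 / ξ := by
  set A : ℂ := ∫ y in (0 : ℝ)..1, Complex.exp (-(ξ * Complex.I) * (y : ℂ) ^ 2) with hA
  set B : ℂ := (Real.pi / (ξ * Complex.I)) ^ (1 / 2 : ℂ) / 2 with hB
  set w : ℂ := Complex.exp (((ξ + θ : ℝ) : ℂ) * Complex.I) with hw
  have hwn : ‖w‖ = 1 := Complex.norm_exp_ofReal_mul_I _
  have h1 : (∫ y in (0 : ℝ)..1, Real.sin (ξ * (1 - y ^ 2) + θ)) = (w * A).im := by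
    have h2 : w * A = ∫ y in (0 : ℝ)..1, w * Complex.exp (-(ξ * Complex.I) * (y : ℂ) ^ 2) := by
      rw [hA, intervalIntegral.integral_const_mul]
    have hc : Continuous fun y : ℝ => w * Complex.exp (-(ξ * Complex.I) * (y : ℂ) ^ 2) := by
      fun_prop
    have h3 := Complex.imCLM.intervalIntegral_comp_comm
      (hc.intervalIntegrable (μ := MeasureTheory.volume) 0 1)
    rw [h2]
    simp only [Complex.imCLM_apply] at h3
    rw [← h3]
    refine intervalIntegral.integral_congr fun y _ => ?_
    have h4 : w * Complex.exp (-(ξ * Complex.I) * (y : ℂ) ^ 2)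
        = Complex.exp (((ξ * (1 - y ^ 2) + θ : ℝ) : ℂ) * Complex.I) := by
      rw [hw, ← Complex.exp_add]
      congr 1
      push_cast
      ring
    simp only [h4, Complex.exp_ofReal_mul_I_im]
  have h5 : Real.sqrt (Real.pi / ξ) / 2 * Real.sin (ξ + θ - Real.pi / 4) = (w * B).im := by
    have h6 : w * B = ((Real.sqrt (Real.pi / ξ) / 2 : ℝ) : ℂ)
        * Complex.exp (((ξ + θ - Real.pi / 4 : ℝ) : ℂ) * Complex.I) := by
      have h7 : Complex.exp (((ξ + θ - Real.pi / 4 : ℝ) : ℂ) * Complex.I)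
          = w * Complex.exp (-(Real.pi / 4) * Complex.I) := by
        rw [hw, ← Complex.exp_add]
        congr 1
        push_cast
        ring
      rw [h7, hB, cpow_half_pi_div hξ]
      push_cast
      ring
    rw [h6, Complex.im_ofReal_mul, Complex.exp_ofReal_mul_I_im]
  rw [h1, h5, ← Complex.sub_im, ← mul_sub]
  calc _ ≤ ‖w * (A - B)‖ := Complex.abs_im_le_norm _
    _ = ‖A - B‖ := by rw [norm_mul, hwn, one_mul]
    _ ≤ 1 / ξ := norm_fresnel_sub_le hξ

/-! ### Stationary phase at the origin -/

theorem AnalyticAt.dslope_self {D : ℝ → ℝ} {a : ℝ} (h : AnalyticAt ℝ D a) :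
    AnalyticAt ℝ (dslope D a) a := by
  obtain ⟨p, hp⟩ := h
  exact ⟨_, hp.has_fpower_series_dslope_fslope⟩

theorem AnalyticOnNhd.dslope {D : ℝ → ℝ} {s : Set ℝ} {a : ℝ} (h : AnalyticOnNhd ℝ D s) :
    AnalyticOnNhd ℝ (dslope D a) s := fun t ht => by
  by_cases hta : t = a
  · rw [hta]; exact (hta ▸ h t ht).dslope_self
  · have h1 : AnalyticAt ℝ (fun t => (t - a)⁻¹ * (D t - D a)) t :=
      ((analyticAt_id.sub analyticAt_const).inv (sub_ne_zero.2 hta)).mul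
        ((h t ht).sub analyticAt_const)
    refine h1.congr ?_
    filter_upwards [isOpen_ne.mem_nhds hta] with u hu
    rw [dslope_of_ne _ hu, slope_def_field]
    field_simp

theorem eq_add_mul_dslope (D : ℝ → ℝ) (t : ℝ) : D t = D 0 + t * dslope D 0 t := by
  have := sub_smul_dslope D 0 t
  simp only [sub_zero, smul_eq_mul] at this
  linarith

/-- The stationary phase formula at the origin. -/
theorem phaseIntegral_zero_isBigO {F G : ℝ → ℝ} (hF : AnalyticOnNhd ℝ F (Icc 0 1))
    (hF' : ∀ t ∈ Icc (0 : ℝ) 1, deriv F t < 0) (hF0 : F 0 = 1) (hF1 : F 1 = 0)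
    (hG : AnalyticOnNhd ℝ G (Icc 0 1)) (θ : ℝ) :
    (fun ξ => phaseIntegral F 0 θ G ξ - G 0 / Real.sqrt (-deriv F 0) *
      (Real.sqrt (Real.pi / ξ) / 2 * Real.sin (ξ + θ - Real.pi / 4))) =O[atTop] fun ξ => ξ⁻¹ := by
  have h0mem : (0 : ℝ) ∈ Icc (0 : ℝ) 1 := ⟨le_rfl, zero_le_one⟩
  have h1mem : (1 : ℝ) ∈ Icc (0 : ℝ) 1 := ⟨zero_le_one, le_rfl⟩
  -- Writing `F = 1 - t q` with `q > 0`, the substitution `y = r √q(r²)` turns the phase into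
  -- exactly `1 - y²` and maps `[0, 1]` onto itself.
  set q : ℝ → ℝ := fun t => -dslope F 0 t with hq
  have hqF : ∀ t, F t = 1 - t * q t := fun t => by
    have := eq_add_mul_dslope F t
    rw [hF0] at this
    rw [this, hq]; ring
  have hqa : AnalyticOnNhd ℝ q (Icc 0 1) := fun t ht => (hF.dslope t ht).neg
  have hanti : StrictAntiOn F (Icc 0 1) := by
    refine strictAntiOn_of_deriv_neg (convex_Icc 0 1) hF.continuousOn fun t ht => ?_
    rw [interior_Icc] at ht
    exact hF' t ⟨ht.1.le, ht.2.le⟩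
  have hq0 : q 0 = -deriv F 0 := by simp [hq]
  have hqpos : ∀ t ∈ Icc (0 : ℝ) 1, 0 < q t := by
    intro t ht
    rcases ht.1.eq_or_lt with h | h
    · rw [← h, hq0]; linarith [hF' 0 h0mem]
    · have := hanti h0mem ht h
      rw [hF0, hqF t] at this
      have h2 : 0 < t * q t := by linarith
      exact (pos_iff_pos_of_mul_pos h2).1 h
  -- The square root of `q`, written through `exp` and `log` so that its analyticity is immediate.
  set s : ℝ → ℝ := fun t => Real.exp (Real.log (q t) / 2) with hs
  have hsa : AnalyticOnNhd ℝ s (Icc 0 1) := fun t ht =>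
    ((hqa t ht).log (hqpos t ht)).div_const.rexp
  have hspos : ∀ t, 0 < s t := fun t => Real.exp_pos _
  have hs2 : ∀ t ∈ Icc (0 : ℝ) 1, s t ^ 2 = q t := fun t ht => by
    rw [hs, ← Real.exp_nat_mul]
    push_cast
    rw [mul_div_cancel₀ _ two_ne_zero, Real.exp_log (hqpos t ht)]
  have hs0 : s 0 = Real.sqrt (-deriv F 0) := by
    rw [← hq0, ← hs2 0 h0mem, Real.sqrt_sq (hspos 0).le]
  have hs1 : s 1 = 1 := by
    have h1 : q 1 = 1 := by have := hqF 1; rw [hF1] at this; linarith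
    simp [hs, h1]
  set Y : ℝ → ℝ := fun t => s t + 2 * t * deriv s t with hY
  have hYa : AnalyticOnNhd ℝ Y (Icc 0 1) := fun t ht =>
    (hsa t ht).add ((analyticAt_const.mul analyticAt_id).mul (hsa t ht).deriv)
  -- Here `Y(r²) = dy/dr` and `Y 0 = s 0`. This `c` makes `G - cY` vanish at `0`, so the remainder
  -- carries an extra `r²` and is `O(1/ξ)`.
  set c : ℝ := G 0 / s 0 with hc
  set D : ℝ → ℝ := fun t => G t - c * Y t with hD
  have hDa : AnalyticOnNhd ℝ D (Icc 0 1) := fun t ht =>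
    (hG t ht).sub (analyticAt_const.mul (hYa t ht))
  have hD0 : D 0 = 0 := by
    have := (hspos 0).ne'
    simp only [hD, hY, hc]
    field_simp
    ring
  have hGD : ∀ t, G t = c * Y t + t * dslope D 0 t := fun t => by
    have := eq_add_mul_dslope D t
    rw [hD0, zero_add] at this
    rw [← this, hD]; ring
  have hsplit : ∀ ξ, phaseIntegral F 0 θ G ξ
      = c * phaseIntegral F 0 θ Y ξ + phaseIntegral F 2 θ (dslope D 0) ξ := by
    intro ξ
    rw [phaseIntegral, phaseIntegral, phaseIntegral, ← intervalIntegral.integral_const_mul,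
      ← intervalIntegral.integral_add ((intervalIntegrable_phase hF hYa 0 θ ξ).const_mul c)
        (intervalIntegrable_phase hF hDa.dslope 2 θ ξ)]
    refine intervalIntegral.integral_congr fun r _ => ?_
    simp only [hGD (r ^ 2)]
    ring
  have hsub : ∀ ξ, phaseIntegral F 0 θ Y ξ
      = ∫ y in (0 : ℝ)..1, Real.sin (ξ * (1 - y ^ 2) + θ) := by
    intro ξ
    have hy : ∀ r ∈ uIcc (0 : ℝ) 1, HasDerivAt (fun r => r * s (r ^ 2)) (Y (r ^ 2)) r := by
      intro r hr
      rw [uIcc_of_le zero_le_one] at hr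
      have := (hasDerivAt_id r).mul (hsa _ (sq_mem_Icc hr)).differentiableAt.hasDerivAt.comp_sq
      refine this.congr_deriv ?_
      simp only [hY, id]
      ring
    have hsubst := intervalIntegral.integral_comp_mul_deriv hy
      (by rw [uIcc_of_le zero_le_one]; exact hYa.continuousOn_comp_sq)
      (g := fun y => Real.sin (ξ * (1 - y ^ 2) + θ)) (by fun_prop)
    simp only [zero_mul, one_pow, one_mul, hs1] at hsubst
    rw [← hsubst, phaseIntegral]
    refine intervalIntegral.integral_congr fun r hr => ?_
    rw [uIcc_of_le zero_le_one] at hr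
    have h2 := hs2 _ (sq_mem_Icc hr)
    simp only [Function.comp, pow_zero, mul_one, hqF (r ^ 2)]
    rw [mul_pow, h2]
  have hmain : (fun ξ => phaseIntegral F 0 θ Y ξ
      - Real.sqrt (Real.pi / ξ) / 2 * Real.sin (ξ + θ - Real.pi / 4)) =O[atTop] fun ξ => ξ⁻¹ := by
    refine IsBigO.of_bound 1 ?_
    filter_upwards [eventually_gt_atTop 0] with ξ hξ
    rw [hsub, Real.norm_eq_abs, one_mul, Real.norm_eq_abs, abs_of_pos (inv_pos.2 hξ), ← one_div]
    exact abs_integral_sin_sub_le hξ θ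
  have hrest := phaseIntegral_succ_isBigO hF (fun t ht => (hF' t ht).ne) (hDa.dslope (a := 0)) 1 θ
  refine ((hmain.const_mul_left c).add hrest).congr' (Eventually.of_forall fun ξ => ?_)
    EventuallyEq.rfl
  simp only [hsplit, ← hs0, ← hc]
  ring

/-! ### Counting sign changes -/

/-- A continuous function with finitely many zeros has finitely many sign changes. -/
theorem numSignChanges_lt_top_of_finite {F : ℝ → ℝ} (hF : Continuous F) {a : ℝ}
    (hZ : {x ∈ Ioi a | F x = 0}.Finite) : numSignChanges F (Ioi a) < ⊤ := by
  set Z : Set ℝ := {x ∈ Ioi a | F x = 0} with hZdef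
  have hle : numSignChanges F (Ioi a) ≤ (Z.ncard : ℕ∞) := by
    refine iSup₂_le fun k hk => ?_
    obtain ⟨x, hx, hxS, hsign⟩ := hk
    have hzero : ∀ i : Fin k, ∃ z ∈ Icc (x i.castSucc) (x i.succ), F z = 0 := by
      intro i
      have hle : x i.castSucc ≤ x i.succ := (hx Fin.castSucc_lt_succ).le
      rcases mul_neg_iff.1 (hsign i) with h | h
      · obtain ⟨z, hz, hz0⟩ := intermediate_value_Icc' hle hF.continuousOn ⟨h.2.le, h.1.le⟩
        exact ⟨z, hz, hz0⟩
      · obtain ⟨z, hz, hz0⟩ := intermediate_value_Icc hle hF.continuousOn ⟨h.1.le, h.2.le⟩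
        exact ⟨z, hz, hz0⟩
    choose z hz hz0 using hzero
    -- The zeros from adjacent intervals are distinct, since `F` does not vanish at the common
    -- endpoint.
    have hlt : ∀ i : Fin k, z i < x i.succ := fun i => by
      refine lt_of_le_of_ne (hz i).2 fun h => ?_
      have := hsign i
      rw [← h, hz0, mul_zero] at this
      exact lt_irrefl _ this
    have hmono : StrictMono z := fun i j hij =>
      (hlt i).trans_le ((hx.monotone (Fin.succ_le_castSucc_iff.2 hij)).trans (hz j).1)
    have hmem : ∀ i, z i ∈ Z := fun i => ⟨lt_of_lt_of_le (hxS _) (hz i).1, hz0 i⟩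
    have hcard : k ≤ Z.ncard := by
      have h1 : (range z).ncard = k := by
        rw [← image_univ, ncard_image_of_injective _ hmono.injective, ncard_univ]
        simp
      rw [← h1]
      exact ncard_le_ncard (range_subset_iff.2 hmem) hZ
    exact_mod_cast hcard
  exact hle.trans_lt (ENat.natCast_lt_top _)

/-- An analytic function which is eventually positive has finitely many sign changes. -/
theorem numSignChanges_lt_top_of_analytic {F : ℝ → ℝ} (hF : AnalyticOnNhd ℝ F univ) (a : ℝ)
    (hpos : ∀ᶠ x in atTop, 0 < F x) : numSignChanges F (Ioi a) < ⊤ := by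
  have hc : Continuous F := continuous_iff_continuousAt.2 fun x => (hF x (mem_univ x)).continuousAt
  obtain ⟨M, hM⟩ := eventually_atTop.1 hpos
  refine numSignChanges_lt_top_of_finite hc ?_
  by_contra hinf
  -- Infinitely many zeros in a compact interval would accumulate, and the identity theorem would
  -- make `F` vanish everywhere.
  have hsub : {x ∈ Ioi a | F x = 0} ⊆ Icc a M := fun x hx =>
    ⟨le_of_lt hx.1, le_of_not_ge fun h => (hM x h).ne' hx.2⟩
  obtain ⟨z, -, hz⟩ := Set.Infinite.exists_accPt_of_subset_isCompact hinf isCompact_Icc hsub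
  have hfreq : ∃ᶠ y in 𝓝[≠] z, F y = 0 :=
    (accPt_iff_frequently_nhdsNE.1 hz).mono fun y hy => hy.2
  have := hF.eqOn_zero_of_preconnected_of_frequently_eq_zero isPreconnected_univ (mem_univ z) hfreq
    (mem_univ M)
  exact (hM M le_rfl).ne' this

theorem isLittleO_rpow_of_lt {p q : ℝ} (hpq : q < p) :
    (fun ξ : ℝ => ξ ^ q) =o[atTop] fun ξ => ξ ^ p := by
  have hpos : ∀ᶠ ξ : ℝ in atTop, 0 < ξ ^ p := by
    filter_upwards [eventually_gt_atTop 0] with ξ hξ using Real.rpow_pos_of_pos hξ p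
  refine (isLittleO_iff_tendsto' (hpos.mono fun ξ hξ h0 => absurd h0 hξ.ne')).2 ?_
  refine (tendsto_rpow_neg_atTop (sub_pos.2 hpq)).congr' ?_
  filter_upwards [eventually_gt_atTop 0] with ξ hξ
  rw [neg_sub, Real.rpow_sub hξ]

/-- A function asymptotic to a decaying oscillation changes sign infinitely often. -/
theorem numSignChanges_eq_top_of_oscillation {F : ℝ → ℝ} {A θ p q : ℝ} (a : ℝ) (hA : A ≠ 0)
    (hpq : q < p) (hF : (fun ξ => F ξ - A * Real.sin (ξ - θ) * ξ ^ p) =O[atTop] fun ξ => ξ ^ q) :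
    numSignChanges F (Ioi a) = ⊤ := by
  have ho : (fun ξ : ℝ => ξ ^ q) =o[atTop] fun ξ => ξ ^ p := isLittleO_rpow_of_lt hpq
  have hb := (hF.trans_isLittleO ho).bound (half_pos (abs_pos.2 hA))
  obtain ⟨M, hM⟩ := eventually_atTop.1 hb
  obtain ⟨K, hK⟩ := exists_nat_gt ((max (max M a) 0 - θ) / Real.pi)
  rw [div_lt_iff₀ Real.pi_pos] at hK
  -- At these points the sine is alternately `1` and `-1`; `K` places them beyond `M`, `a` and `0`.
  set x : ℕ → ℝ := fun j => θ + Real.pi / 2 + ((K + j : ℕ) : ℝ) * Real.pi with hx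
  have hxlarge : ∀ j, max (max M a) 0 < x j := fun j => by
    have h1 : (0 : ℝ) ≤ (j : ℝ) * Real.pi := mul_nonneg (Nat.cast_nonneg j) Real.pi_pos.le
    have := Real.pi_pos
    simp only [hx]
    push_cast
    linarith
  have hsign : ∀ j, 0 < F (x j) * ((-1) ^ (K + j) * A) := fun j => by
    have hpos : 0 < x j := (le_max_right _ _).trans_lt (hxlarge j)
    have hMj : M ≤ x j := ((le_max_left _ _).trans (le_max_left _ _)).trans (hxlarge j).le
    have h1 := hM _ hMj
    have h2 : Real.sin (x j - θ) = (-1) ^ (K + j) := by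
      have : x j - θ = Real.pi / 2 + ((K + j : ℕ) : ℝ) * Real.pi := by simp only [hx]; ring
      rw [this, Real.sin_add_nat_mul_pi, Real.sin_pi_div_two, mul_one]
    have hp : 0 < x j ^ p := Real.rpow_pos_of_pos hpos p
    rw [h2, Real.norm_eq_abs, Real.norm_eq_abs, abs_of_pos hp] at h1
    set s : ℝ := (-1) ^ (K + j) with hs
    have hs2 : s * s = 1 := by rw [hs, ← mul_pow]; norm_num
    have habs : |s * A| = |A| := by
      rw [abs_mul, hs, abs_pow]; simp
    have h3 : |(F (x j) - A * s * x j ^ p) * (s * A)| ≤ |A| / 2 * x j ^ p * |A| := by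
      rw [abs_mul, habs]
      gcongr
    have h4 := (abs_le.1 h3).1
    have h5 : |A| * |A| = A * A := abs_mul_abs_self A
    have h6 : 0 < A * A * x j ^ p := mul_pos (mul_self_pos.2 hA) hp
    have h7 : (F (x j) - A * s * x j ^ p) * (s * A)
        = F (x j) * (s * A) - (A * A * x j ^ p) * (s * s) := by ring
    have h8 : |A| / 2 * x j ^ p * |A| = (|A| * |A|) * x j ^ p / 2 := by ring
    rw [h7, hs2, h8, h5] at h4
    linarith
  refine ENat.eq_top_iff_forall_ge.2 fun k => ?_
  refine le_iSup₂_of_le k ?_ le_rfl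
  refine ⟨fun i => x i, fun i j hij => ?_, fun i => ?_, fun i => ?_⟩
  · simp only [hx]
    have : (i : ℕ) < j := hij
    gcongr
  · exact ((le_max_right _ _).trans (le_max_left _ _)).trans_lt (hxlarge i)
  · have h1 := mul_pos (hsign i) (hsign (i + 1))
    simp only [Fin.val_castSucc, Fin.val_succ]
    have h2 : F (x i) * ((-1) ^ (K + (i : ℕ)) * A) * (F (x (i + 1)) * ((-1) ^ (K + (i + 1 : ℕ)) * A))
        = -(F (x i) * F (x (i + 1))) * (((-1 : ℝ) ^ (K + (i : ℕ))) ^ 2 * A ^ 2) := by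
      rw [← add_assoc, pow_succ]; ring
    have h3 : ((-1 : ℝ) ^ (K + (i : ℕ))) ^ 2 = 1 := by rw [← pow_mul, mul_comm, pow_mul]; simp
    rw [h2, h3, one_mul] at h1
    have := (pos_iff_pos_of_mul_pos h1).2 (by positivity)
    linarith

/-! ### Analyticity in the frequency -/

/-- The oscillating integral is a real analytic function of the frequency. -/
theorem analyticOnNhd_oscIntegral (n : ℕ) {φ : ℝ → ℝ} (hφ : ContinuousOn φ (Icc 0 1)) :
    AnalyticOnNhd ℝ (oscIntegral n φ) univ := by
  obtain ⟨C, hC⟩ := isCompact_Icc.exists_bound_of_continuousOn hφ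
  set g : ℂ → ℝ → ℂ := fun z r => Complex.sin (z * φ r) * φ r * (r : ℂ) ^ (n - 1) with hg
  set g' : ℂ → ℝ → ℂ := fun z r => Complex.cos (z * φ r) * φ r * φ r * (r : ℂ) ^ (n - 1) with hg'
  have hφc : ContinuousOn (fun r => (φ r : ℂ)) (uIcc 0 1) := by
    rw [uIcc_of_le zero_le_one]
    exact Complex.continuous_ofReal.comp_continuousOn hφ
  have hgc : ∀ z, ContinuousOn (g z) (uIcc 0 1) := fun z =>
    ((Complex.continuous_sin.comp_continuousOn (continuousOn_const.mul hφc)).mul hφc).mul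
      (by fun_prop)
  have hgc' : ∀ z, ContinuousOn (g' z) (uIcc 0 1) := fun z =>
    (((Complex.continuous_cos.comp_continuousOn (continuousOn_const.mul hφc)).mul hφc).mul
      hφc).mul (by fun_prop)
  -- The integral extends to complex frequencies, where differentiability under the integral sign
  -- already gives analyticity; `J` is its restriction to the real axis.
  have hdiff : Differentiable ℂ fun z => ∫ r in (0 : ℝ)..1, g z r := by
    intro z₀
    refine (intervalIntegral.hasDerivAt_integral_of_dominated_loc_of_deriv_le (F' := g')
      (bound := fun _ => Real.exp ((‖z₀‖ + 1) * C) * C * C)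
      (Metric.ball_mem_nhds z₀ one_pos) ?_ ?_ ?_ ?_ ?_ ?_).2.differentiableAt
    · exact Eventually.of_forall fun z =>
        (hgc z).intervalIntegrable.aestronglyMeasurable_restrict_uIoc
    · exact (hgc z₀).intervalIntegrable
    · exact (hgc' z₀).intervalIntegrable.aestronglyMeasurable_restrict_uIoc
    · refine Eventually.of_forall fun r hr z hz => ?_
      rw [uIoc_of_le zero_le_one] at hr
      have h1 : ‖(φ r : ℂ)‖ ≤ C := by
        rw [Complex.norm_real]; exact hC r ⟨hr.1.le, hr.2⟩
      have hC0 : 0 ≤ C := (norm_nonneg _).trans h1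
      have h2 : ‖z‖ ≤ ‖z₀‖ + 1 := by
        rw [mem_ball_iff_norm] at hz
        linarith [norm_sub_norm_le z z₀]
      have h3 : ‖Complex.cos (z * φ r)‖ ≤ Real.exp ((‖z₀‖ + 1) * C) := by
        have hle : ‖z * φ r‖ ≤ (‖z₀‖ + 1) * C := by rw [norm_mul]; gcongr
        have he : ∀ w : ℂ, ‖w‖ ≤ (‖z₀‖ + 1) * C → ‖Complex.exp w‖ ≤ Real.exp ((‖z₀‖ + 1) * C) :=
          fun w hw => by
            rw [Complex.norm_exp]
            exact Real.exp_le_exp.2 ((Complex.re_le_norm w).trans hw)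
        rw [Complex.cos, norm_div, Complex.norm_ofNat, div_le_iff₀ two_pos]
        refine (norm_add_le _ _).trans ?_
        have e1 := he (z * φ r * Complex.I) (by simpa using hle)
        have e2 := he (-(z * φ r) * Complex.I) (by simpa using hle)
        linarith
      have h4 : ‖(r : ℂ) ^ (n - 1)‖ ≤ 1 := by
        rw [norm_pow, Complex.norm_real, Real.norm_eq_abs, abs_of_pos hr.1]
        exact pow_le_one₀ hr.1.le hr.2
      calc ‖g' z r‖ = ‖Complex.cos (z * φ r)‖ * ‖(φ r : ℂ)‖ * ‖(φ r : ℂ)‖ * ‖(r : ℂ) ^ (n - 1)‖ := by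
            simp only [hg', norm_mul]
        _ ≤ Real.exp ((‖z₀‖ + 1) * C) * C * C * 1 := by gcongr
        _ = _ := mul_one _
    · exact intervalIntegrable_const
    · refine Eventually.of_forall fun r _ z _ => ?_
      have h1 : HasDerivAt (fun z : ℂ => z * φ r) (φ r) z := by
        simpa using (hasDerivAt_id z).mul_const (φ r : ℂ)
      exact ((h1.csin.mul_const (φ r : ℂ)).mul_const ((r : ℂ) ^ (n - 1)))
  intro ξ _
  have h1 : AnalyticAt ℂ (fun z => ∫ r in (0 : ℝ)..1, g z r) (ξ : ℂ) := hdiff.analyticAt _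
  have h2 := h1.re_ofReal
  refine h2.congr (Eventually.of_forall fun y => ?_)
  have h3 : ∀ r : ℝ, g y r = ((Real.sin (y * φ r) * φ r * r ^ (n - 1) : ℝ) : ℂ) := fun r => by
    simp only [hg]; push_cast; rfl
  simp only [h3, intervalIntegral.integral_ofReal, Complex.ofReal_re]
  rfl

/-! ### Asymptotics, dimension by dimension -/

/-- Common form of the remainders after `j` integrations by parts. For `n = 2, 4, 6` the true order
`ξ^(-(j+1))` is better than the one claimed, hence the inequality on `q`. -/
theorem isBigO_rpow_of_mul_isBigO_inv {f h : ℝ → ℝ} {c q : ℝ} (j : ℕ)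
    (hf : ∀ ξ, 0 < ξ → f ξ = c * ξ⁻¹ ^ j * h ξ) (hh : h =O[atTop] fun ξ => ξ⁻¹)
    (hq : -((j : ℝ) + 1) ≤ q) : f =O[atTop] fun ξ => ξ ^ q := by
  have h1 : (fun ξ : ℝ => c * ξ⁻¹ ^ j * h ξ) =O[atTop] fun ξ => ξ⁻¹ ^ j * ξ⁻¹ :=
    ((isBigO_refl (fun ξ : ℝ => ξ⁻¹ ^ j) atTop).const_mul_left c).mul hh
  have h2 : f =O[atTop] fun ξ => ξ⁻¹ ^ j * ξ⁻¹ := by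
    refine h1.congr' ?_ EventuallyEq.rfl
    filter_upwards [eventually_gt_atTop 0] with ξ hξ using (hf ξ hξ).symm
  refine h2.trans (IsBigO.of_bound 1 ?_)
  filter_upwards [eventually_ge_atTop 1] with ξ hξ
  have hξ0 : 0 < ξ := by linarith
  rw [one_mul, ← pow_succ, Real.norm_of_nonneg (by positivity),
    Real.norm_of_nonneg (by positivity), inv_pow, ← Real.rpow_natCast, ← Real.rpow_neg hξ0.le]
  exact Real.rpow_le_rpow_of_exponent_le hξ (by push_cast; exact hq)

theorem sqrt_pi_div_eq {ξ : ℝ} (hξ : 0 < ξ) :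
    Real.sqrt (Real.pi / ξ) = Real.sqrt Real.pi * ξ ^ (-(1 / 2) : ℝ) := by
  rw [Real.sqrt_div' _ hξ.le, Real.rpow_neg hξ.le, ← Real.sqrt_eq_rpow]
  rfl

/-- The constant of the stationary phase formula. -/
theorem half_sqrt_pi_div_sqrt {a : ℝ} (ha : 0 < a) :
    1 / Real.sqrt a * (Real.sqrt Real.pi / 2) = Real.sqrt (Real.pi / (4 * a)) := by
  have h4 : Real.sqrt (4 * a) = 2 * Real.sqrt a := by
    rw [Real.sqrt_mul (by norm_num), show (4 : ℝ) = 2 ^ 2 by norm_num,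
      Real.sqrt_sq (by norm_num)]
  rw [Real.sqrt_div Real.pi_pos.le, h4]
  have := (Real.sqrt_pos.2 ha).ne'
  field_simp

theorem phaseIntegral_tendsto_zero {F G : ℝ → ℝ} (hF : AnalyticOnNhd ℝ F (Icc 0 1))
    (hF' : ∀ t ∈ Icc (0 : ℝ) 1, deriv F t < 0) (hF0 : F 0 = 1) (hF1 : F 1 = 0)
    (hG : AnalyticOnNhd ℝ G (Icc 0 1)) (k : ℕ) (θ : ℝ) :
    Tendsto (phaseIntegral F k θ G) atTop (𝓝 0) := by
  rcases k with _ | k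
  · have h1 := (phaseIntegral_zero_isBigO hF hF' hF0 hF1 hG θ).trans_tendsto tendsto_inv_atTop_zero
    have h2 : Tendsto (fun ξ : ℝ => G 0 / Real.sqrt (-deriv F 0) *
        (Real.sqrt (Real.pi / ξ) / 2 * Real.sin (ξ + θ - Real.pi / 4))) atTop (𝓝 0) := by
      have h3 : Tendsto (fun ξ : ℝ => Real.sqrt (Real.pi / ξ) / 2) atTop (𝓝 0) := by
        have : Tendsto (fun ξ : ℝ => Real.pi / ξ) atTop (𝓝 0) :=
          tendsto_const_nhds.div_atTop tendsto_id
        have := ((Real.continuous_sqrt.tendsto 0).comp this).div_const 2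
        simpa using this
      have h4 := h3.zero_mul_isBoundedUnder_le (g := fun ξ => Real.sin (ξ + θ - Real.pi / 4))
        (isBoundedUnder_of ⟨1, fun ξ => by simpa using Real.abs_sin_le_one _⟩)
      simpa using h4.const_mul (G 0 / Real.sqrt (-deriv F 0))
    simpa using h1.add h2
  · exact (phaseIntegral_succ_isBigO hF (fun t ht => (hF' t ht).ne) hG k θ).trans_tendsto
      tendsto_inv_atTop_zero

theorem transportAmplitude_zero (F : ℝ → ℝ) (k : ℕ) (G : ℝ → ℝ) :
    transportAmplitude F k G 0 = k * (G 0 / deriv F 0) := by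
  simp [transportAmplitude]

theorem oscIntegral_eq_phaseIntegral (n : ℕ) {F φ : ℝ → ℝ}
    (hφ : ∀ r ∈ Icc (0 : ℝ) 1, φ r = F (r ^ 2)) (ξ : ℝ) :
    oscIntegral n φ ξ = phaseIntegral F (n - 1) 0 F ξ := by
  refine intervalIntegral.integral_congr fun r hr => ?_
  rw [uIcc_of_le zero_le_one] at hr
  simp only [hφ r hr, add_zero]

namespace IsPrincipalRadialSeries

variable {n : ℕ} {lam : ℝ} {F : ℝ → ℝ}

theorem analyticOnNhd (h : IsPrincipalRadialSeries n lam F) : AnalyticOnNhd ℝ F (Icc 0 1) :=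
  fun t _ => h.analyticAt t

theorem deriv_ne_zero (h : IsPrincipalRadialSeries n lam F) :
    ∀ t ∈ Icc (0 : ℝ) 1, deriv F t ≠ 0 := fun t ht => (h.deriv_neg t ht).ne

theorem analyticOnNhd_transport (h : IsPrincipalRadialSeries n lam F) {G : ℝ → ℝ}
    (hG : AnalyticOnNhd ℝ G (Icc 0 1)) (k : ℕ) :
    AnalyticOnNhd ℝ (transportAmplitude F k G) (Icc 0 1) :=
  h.analyticOnNhd.transportAmplitude h.deriv_ne_zero hG k

/-- The first integration by parts produces no boundary term, since `F 1 = 0`. -/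
theorem phaseIntegral_self (h : IsPrincipalRadialSeries n lam F) (k : ℕ) {ξ : ℝ} (hξ : 0 < ξ) :
    phaseIntegral F (k + 2) 0 F ξ
      = -(1 / 2) * ξ⁻¹ * phaseIntegral F k (-(Real.pi / 2)) (transportAmplitude F (k + 1) F) ξ := by
  rw [phaseIntegral_add_two h.analyticOnNhd h.deriv_ne_zero h.analyticOnNhd k 0 hξ, h.one,
    zero_sub]
  field_simp
  ring

/-- The second integration by parts produces no boundary term, since the phase vanishes. -/
theorem phaseIntegral_neg_pi_div_two (h : IsPrincipalRadialSeries n lam F) {G : ℝ → ℝ}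
    (hG : AnalyticOnNhd ℝ G (Icc 0 1)) (k : ℕ) {ξ : ℝ} (hξ : 0 < ξ) :
    phaseIntegral F (k + 2) (-(Real.pi / 2)) G ξ
      = -(1 / 2) * ξ⁻¹ * phaseIntegral F k (-Real.pi) (transportAmplitude F (k + 1) G) ξ := by
  have e : -(Real.pi / 2) - Real.pi / 2 = -Real.pi := by ring
  rw [phaseIntegral_add_two h.analyticOnNhd h.deriv_ne_zero hG k _ hξ, h.one, e, mul_zero,
    zero_add, Real.sin_neg, Real.sin_pi]
  field_simp
  ring

theorem sin_neg_pi_sub : Real.sin (-Real.pi - Real.pi / 2) = 1 := by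
  rw [Real.sin_sub_pi_div_two, Real.cos_neg, Real.cos_pi, neg_neg]

theorem phaseIntegral_neg_pi (h : IsPrincipalRadialSeries n lam F) {G : ℝ → ℝ}
    (hG : AnalyticOnNhd ℝ G (Icc 0 1)) (k : ℕ) {ξ : ℝ} (hξ : 0 < ξ) :
    phaseIntegral F (k + 2) (-Real.pi) G ξ
      = 1 / 2 * ξ⁻¹ * (G 1 / deriv F 1
        - phaseIntegral F k (-Real.pi - Real.pi / 2) (transportAmplitude F (k + 1) G) ξ) := by
  rw [phaseIntegral_add_two h.analyticOnNhd h.deriv_ne_zero hG k _ hξ, h.one, mul_zero,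
    zero_add, sin_neg_pi_sub]
  field_simp

/-- The amplitude at the boundary after two integrations by parts. -/
theorem transportAmplitude_transportAmplitude_one {b : ℕ}
    (h : IsPrincipalRadialSeries (b + 4) lam F) :
    transportAmplitude F b (transportAmplitude F (b + 2) F) 1
      = 8 * ((b : ℝ) + 3) / deriv F 1 := by
  have h1mem : (1 : ℝ) ∈ Icc (0 : ℝ) 1 := ⟨zero_le_one, le_rfl⟩
  have hd := h.deriv_ne_zero 1 h1mem
  -- The equation at `t = 1`, where the term in `F` drops out. With `H = F/F'` it yields `H(1) = 0`,
  -- `H'(1) = 1` and `H''(1) = (b+4)/2`.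
  have hF'' : deriv (deriv F) 1 = -((b : ℝ) + 4) / 2 * deriv F 1 := by
    have := h.ode 1
    rw [h.one] at this
    push_cast at this
    linarith
  have hdd : ∀ t, HasDerivAt (deriv F) (deriv (deriv F) t) t := fun t =>
    (h.analyticAt t).deriv.differentiableAt.hasDerivAt
  have hev : ∀ᶠ t in 𝓝 (1 : ℝ), deriv F t ≠ 0 :=
    (h.analyticAt 1).deriv.continuousAt.eventually_ne hd
  have hH : ∀ t, deriv F t ≠ 0 → HasDerivAt (fun s => F s / deriv F s)
      (1 - F t * deriv (deriv F) t / deriv F t ^ 2) t := fun t ht => by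
    refine ((h.hasDerivAt t).div (hdd t) ht).congr_deriv ?_
    field_simp
  have hH1 : deriv (fun s => F s / deriv F s) 1 = 1 := by
    rw [(hH 1 hd).deriv, h.one]; simp
  have hH2 : HasDerivAt (deriv fun s => F s / deriv F s) (((b : ℝ) + 4) / 2) 1 := by
    have h3 : HasDerivAt (fun t => 1 - F t * deriv (deriv F) t / deriv F t ^ 2)
        (((b : ℝ) + 4) / 2) 1 := by
      have h4 := ((h.hasDerivAt 1).mul
        (h.analyticAt 1).deriv.deriv.differentiableAt.hasDerivAt).div ((hdd 1).pow 2)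
          (pow_ne_zero 2 hd)
      refine (h4.const_sub 1).congr_deriv ?_
      simp only [Pi.mul_apply, Pi.pow_apply, h.one, hF'']
      field_simp
      ring
    refine h3.congr_of_eventuallyEq ?_
    filter_upwards [hev] with t ht using (hH t ht).deriv
  have hG1 : transportAmplitude F (b + 2) F 1 = 2 := by
    simp only [transportAmplitude, hH1, h.one]; norm_num
  have hG1' : HasDerivAt (transportAmplitude F (b + 2) F) (2 * ((b : ℝ) + 4)) 1 := by
    have h3 := ((hH 1 hd).const_mul (((b + 2 : ℕ)) : ℝ)).add
      (((hasDerivAt_id (1 : ℝ)).const_mul 2).mul hH2)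
    refine h3.congr_deriv ?_
    simp only [hH1, h.one, id]
    push_cast
    ring
  have hq : deriv (fun s => transportAmplitude F (b + 2) F s / deriv F s) 1
      = 3 * ((b : ℝ) + 4) / deriv F 1 := by
    have h3 : HasDerivAt (fun s => transportAmplitude F (b + 2) F s / deriv F s) _ 1 :=
      hG1'.div (hdd 1) hd
    rw [h3.deriv, hG1, hF'']
    field_simp
    ring
  rw [transportAmplitude, hq, hG1]
  ring

/-- The constant comes from `-F'(0) = lam/(2n)`. -/
theorem stationary (h : IsPrincipalRadialSeries n lam F) {G : ℝ → ℝ}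
    (hG : AnalyticOnNhd ℝ G (Icc 0 1)) (θ : ℝ) :
    (fun ξ => phaseIntegral F 0 θ G ξ - G 0 * Real.sqrt (n * Real.pi / (2 * lam))
      * Real.sin (ξ + θ - Real.pi / 4) * ξ ^ (-(1 / 2) : ℝ)) =O[atTop] fun ξ => ξ⁻¹ := by
  refine (phaseIntegral_zero_isBigO h.analyticOnNhd h.deriv_neg h.zero h.one hG θ).congr' ?_
    EventuallyEq.rfl
  filter_upwards [eventually_gt_atTop 0] with ξ hξ
  have hn := h.one_le_cast
  have hlam := h.lam_pos
  have ha : 0 < -deriv F 0 := by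
    linarith [h.deriv_neg 0 ⟨le_rfl, zero_le_one⟩]
  have e : (n : ℝ) * Real.pi / (2 * lam) = Real.pi / (4 * -deriv F 0) := by
    rw [h.deriv_zero]
    have : (n : ℝ) ≠ 0 := by linarith
    field_simp
    norm_num
  rw [sqrt_pi_div_eq hξ, e, ← half_sqrt_pi_div_sqrt ha]
  ring

theorem isBigO_one (h : IsPrincipalRadialSeries 1 lam F) :
    (fun ξ => phaseIntegral F 0 0 F ξ
      - Real.sqrt (Real.pi / (2 * lam)) * Real.sin (ξ - Real.pi / 4) * ξ ^ (-(1 / 2) : ℝ))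
        =O[atTop] fun ξ : ℝ => ξ ^ (-1 : ℝ) := by
  refine isBigO_rpow_of_mul_isBigO_inv (c := 1) 0 (fun ξ _ => ?_)
    (h.stationary h.analyticOnNhd 0) (by norm_num)
  rw [h.zero]
  simp

theorem isBigO_two (h : IsPrincipalRadialSeries 2 lam F) :
    (fun ξ => phaseIntegral F 1 0 F ξ - (-(2 / lam) * Real.cos ξ * ξ ^ (-1 : ℝ)))
        =O[atTop] fun ξ : ℝ => ξ ^ (-(3 / 2) : ℝ) := by
  refine isBigO_rpow_of_mul_isBigO_inv (c := -(1 / 2)) 1 (fun ξ hξ => ?_)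
    (phaseIntegral_succ_isBigO h.analyticOnNhd h.deriv_ne_zero
      (G := fun t => 2 * deriv (fun s => F s / deriv F s) t)
      (fun t ht => analyticAt_const.mul
        (h.analyticOnNhd.div_deriv h.deriv_ne_zero h.analyticOnNhd t ht).deriv) 0
      (0 - Real.pi / 2)) (by norm_num)
  have hlam := h.lam_pos.ne'
  have e : ξ + (0 - Real.pi / 2) = ξ - Real.pi / 2 := by ring
  rw [phaseIntegral_one h.analyticOnNhd h.deriv_ne_zero h.analyticOnNhd 0 hξ, h.one, h.zero,
    h.deriv_zero, Real.rpow_neg_one, mul_one, e, Real.sin_sub_pi_div_two]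
  push_cast
  field_simp
  ring

/-- One integration by parts reduces `r²` to `r⁰`; only the value of the new amplitude at `0` enters
the leading term. -/
theorem isBigO_three (h : IsPrincipalRadialSeries 3 lam F) :
    (fun ξ => phaseIntegral F 2 0 F ξ
          - (-(3 / lam) * Real.sqrt (3 * Real.pi / (2 * lam)) * Real.cos (ξ - Real.pi / 4)
              * ξ ^ (-(3 / 2) : ℝ)))
        =O[atTop] fun ξ : ℝ => ξ ^ (-2 : ℝ) := by
  refine isBigO_rpow_of_mul_isBigO_inv (c := -(1 / 2)) 1 (fun ξ hξ => ?_)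
    (h.stationary (h.analyticOnNhd_transport h.analyticOnNhd 1) (-(Real.pi / 2))) (by norm_num)
  have hlam := h.lam_pos.ne'
  have e1 : ξ ^ (-(3 / 2) : ℝ) = ξ⁻¹ * ξ ^ (-(1 / 2) : ℝ) := by
    rw [← Real.rpow_neg_one, ← Real.rpow_add hξ]; norm_num
  have e2 : ξ + -(Real.pi / 2) - Real.pi / 4 = (ξ - Real.pi / 4) - Real.pi / 2 := by ring
  rw [h.phaseIntegral_self 0 hξ, transportAmplitude_zero, h.zero, h.deriv_zero, e1, e2,
    Real.sin_sub_pi_div_two]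
  push_cast
  field_simp
  ring

theorem isBigO_four (h : IsPrincipalRadialSeries 4 lam F) :
    (fun ξ => phaseIntegral F 3 0 F ξ - (-(32 / lam ^ 2) * Real.sin ξ * ξ ^ (-2 : ℝ)))
        =O[atTop] fun ξ : ℝ => ξ ^ (-(5 / 2) : ℝ) := by
  have hG := h.analyticOnNhd_transport h.analyticOnNhd 2
  refine isBigO_rpow_of_mul_isBigO_inv (c := 1 / 4) 2 (fun ξ hξ => ?_)
    (phaseIntegral_succ_isBigO h.analyticOnNhd h.deriv_ne_zero
      (G := fun t => 2 * deriv (fun s => transportAmplitude F 2 F s / deriv F s) t)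
      (fun t ht => analyticAt_const.mul
        (h.analyticOnNhd.div_deriv h.deriv_ne_zero hG t ht).deriv) 0
      (-Real.pi)) (by norm_num)
  have hlam := h.lam_pos.ne'
  have e1 : ξ ^ (-2 : ℝ) = ξ⁻¹ ^ 2 := by
    rw [Real.rpow_neg hξ.le, inv_pow]; norm_cast
  have e2 : -(Real.pi / 2) - Real.pi / 2 = -Real.pi := by ring
  rw [h.phaseIntegral_self 1 hξ,
    phaseIntegral_one h.analyticOnNhd h.deriv_ne_zero hG _ hξ, h.one, transportAmplitude_zero,
    h.zero, h.deriv_zero, e1, e2, mul_zero, zero_add, Real.sin_neg, Real.sin_pi, mul_one,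
    ← sub_eq_add_neg, Real.sin_sub_pi]
  push_cast
  field_simp
  ring

theorem isBigO_five (h : IsPrincipalRadialSeries 5 lam F) :
    (fun ξ => phaseIntegral F 4 0 F ξ
          - (-(75 / lam ^ 2) * Real.sqrt (5 * Real.pi / (2 * lam)) * Real.sin (ξ - Real.pi / 4)
              * ξ ^ (-(5 / 2) : ℝ)))
        =O[atTop] fun ξ : ℝ => ξ ^ (-3 : ℝ) := by
  have hG := h.analyticOnNhd_transport h.analyticOnNhd 3
  refine isBigO_rpow_of_mul_isBigO_inv (c := 1 / 4) 2 (fun ξ hξ => ?_)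
    (h.stationary (h.analyticOnNhd_transport hG 1) (-Real.pi)) (by norm_num)
  have hlam := h.lam_pos.ne'
  have e1 : ξ ^ (-(5 / 2) : ℝ) = ξ⁻¹ ^ 2 * ξ ^ (-(1 / 2) : ℝ) := by
    have : ξ⁻¹ ^ 2 = ξ ^ (-2 : ℝ) := by rw [Real.rpow_neg hξ.le, inv_pow]; norm_cast
    rw [this, ← Real.rpow_add hξ]; norm_num
  have e2 : ξ + -Real.pi - Real.pi / 4 = (ξ - Real.pi / 4) - Real.pi := by ring
  rw [h.phaseIntegral_self 2 hξ, h.phaseIntegral_neg_pi_div_two hG 0 hξ, transportAmplitude_zero,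
    transportAmplitude_zero, h.zero, h.deriv_zero, e1, e2, Real.sin_sub_pi]
  push_cast
  field_simp
  ring

/-- After two integrations by parts the weight is `r¹`, and the third has boundary terms at both
ends: the constant from `r = 1`, the cosine from `r = 0`. -/
theorem isBigO_six (h : IsPrincipalRadialSeries 6 lam F) :
    (fun ξ => phaseIntegral F 5 0 F ξ
          - (20 / (2 * deriv F 1) ^ 2 + 1728 / lam ^ 3 * Real.cos ξ) * ξ ^ (-3 : ℝ))
        =O[atTop] (fun ξ : ℝ => ξ ^ (-(7 / 2) : ℝ)) := by
  have hG := h.analyticOnNhd_transport h.analyticOnNhd 4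
  have hG2 := h.analyticOnNhd_transport hG 2
  refine isBigO_rpow_of_mul_isBigO_inv (c := -(1 / 8)) 3 (fun ξ hξ => ?_)
    (phaseIntegral_succ_isBigO h.analyticOnNhd h.deriv_ne_zero
      (G := fun t => 2 * deriv (fun s => transportAmplitude F 2 (transportAmplitude F 4 F) s
        / deriv F s) t)
      (fun t ht => analyticAt_const.mul
        (h.analyticOnNhd.div_deriv h.deriv_ne_zero hG2 t ht).deriv) 0
      (-Real.pi - Real.pi / 2)) (by norm_num)
  have hlam := h.lam_pos.ne'
  have hd := h.deriv_ne_zero 1 ⟨zero_le_one, le_rfl⟩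
  have e1 : ξ ^ (-3 : ℝ) = ξ⁻¹ ^ 3 := by
    rw [Real.rpow_neg hξ.le, inv_pow]; norm_cast
  have e2 : ξ + (-Real.pi - Real.pi / 2) = ξ - Real.pi - Real.pi / 2 := by ring
  have hone := transportAmplitude_transportAmplitude_one (b := 2) h
  norm_num at hone
  rw [h.phaseIntegral_self 3 hξ, h.phaseIntegral_neg_pi_div_two hG 1 hξ,
    phaseIntegral_one h.analyticOnNhd h.deriv_ne_zero hG2 _ hξ, h.one, h.zero, mul_zero,
    zero_add, sin_neg_pi_sub, mul_one, e2, Real.sin_sub_pi_div_two, Real.cos_sub_pi, hone,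
    transportAmplitude_zero, transportAmplitude_zero, h.zero, h.deriv_zero, e1]
  push_cast
  field_simp
  ring

/-- From `φ'(1)² ≤ lam` and `lam ≥ 12`, `1728 φ'(1)² ≤ 1728 lam < 20 · 144 lam ≤ 20 lam³`. -/
theorem six_lt (h : IsPrincipalRadialSeries 6 lam F) :
    1728 / lam ^ 3 < 20 / (2 * deriv F 1) ^ 2 := by
  have h1 := h.two_mul_le_lam
  norm_num at h1
  have h2 := h.sq_deriv_one_le
  have hd := h.deriv_ne_zero 1 ⟨zero_le_one, le_rfl⟩
  have h3 : 0 < (2 * deriv F 1) ^ 2 := by positivity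
  have hlam := h.lam_pos
  rw [div_lt_div_iff₀ (by positivity) h3]
  have h4 : (144 : ℝ) ≤ lam ^ 2 := by nlinarith
  have h5 : lam * 144 ≤ lam * lam ^ 2 := by gcongr
  have h6 : lam ^ 3 = lam * lam ^ 2 := by ring
  rw [h6]
  nlinarith

/-- Here three integrations by parts never reach the origin. The leftover integral tends to `0`,
which requires stationary phase only when `k = 0`. -/
theorem isEquivalent {k : ℕ} (h : IsPrincipalRadialSeries (k + 7) lam F) :
    phaseIntegral F (k + 6) 0 F ~[atTop]
      fun ξ : ℝ => 4 * ((k : ℝ) + 6) / (2 * deriv F 1) ^ 2 * ξ ^ (-3 : ℝ) := by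
  have hd := h.deriv_ne_zero 1 ⟨zero_le_one, le_rfl⟩
  have hG := h.analyticOnNhd_transport h.analyticOnNhd (k + 5)
  have hG2 := h.analyticOnNhd_transport hG (k + 3)
  have hone := transportAmplitude_transportAmplitude_one (b := k + 3) h
  set A : ℝ := 4 * ((k : ℝ) + 6) / (2 * deriv F 1) ^ 2 with hA
  have hA0 : A ≠ 0 := by rw [hA]; positivity
  have hlim := phaseIntegral_tendsto_zero h.analyticOnNhd h.deriv_neg h.zero h.one
    (h.analyticOnNhd_transport hG2 (k + 1)) k (-Real.pi - Real.pi / 2)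
  have hne : ∀ᶠ ξ : ℝ in atTop, A * ξ ^ (-3 : ℝ) ≠ 0 := by
    filter_upwards [eventually_gt_atTop 0] with ξ hξ
    exact mul_ne_zero hA0 (Real.rpow_pos_of_pos hξ _).ne'
  refine (isEquivalent_iff_tendsto_one hne).2 ?_
  have hlim2 : Tendsto (fun ξ => 1 - (8 * A)⁻¹ * phaseIntegral F k (-Real.pi - Real.pi / 2)
      (transportAmplitude F (k + 1) (transportAmplitude F (k + 3)
        (transportAmplitude F (k + 5) F))) ξ) atTop (𝓝 1) := by
    simpa using (hlim.const_mul (8 * A)⁻¹).const_sub 1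
  refine hlim2.congr' ?_
  filter_upwards [eventually_gt_atTop 0] with ξ hξ
  have e1 : ξ ^ (-3 : ℝ) = ξ⁻¹ ^ 3 := by
    rw [Real.rpow_neg hξ.le, inv_pow]; norm_cast
  have hξ0 : ξ⁻¹ ≠ 0 := (inv_pos.2 hξ).ne'
  -- The three integrations contribute `(-1/2)(-1/2)(1/2) = 1/8`, which cancels this `8`.
  have hone' : transportAmplitude F (k + 3) (transportAmplitude F (k + 5) F) 1 / deriv F 1
      = 8 * A := by
    rw [hone, hA]; push_cast; field_simp; ring
  rw [Pi.div_apply, h.phaseIntegral_self (k + 4) hξ,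
    h.phaseIntegral_neg_pi_div_two hG (k + 2) hξ, h.phaseIntegral_neg_pi hG2 k hξ, hone', e1]
  field_simp
  ring

theorem eventually_pos_six (h : IsPrincipalRadialSeries 6 lam F) :
    ∀ᶠ ξ in atTop, 0 < phaseIntegral F 5 0 F ξ := by
  set δ : ℝ := 20 / (2 * deriv F 1) ^ 2 - 1728 / lam ^ 3 with hδ
  have hδ0 : 0 < δ := sub_pos.2 h.six_lt
  have ho := h.isBigO_six.trans_isLittleO
    (isLittleO_rpow_of_lt (by norm_num : (-(7 / 2) : ℝ) < -3))
  filter_upwards [ho.bound (half_pos hδ0), eventually_gt_atTop 0] with ξ hb hξ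
  have hp : 0 < ξ ^ (-3 : ℝ) := Real.rpow_pos_of_pos hξ _
  rw [Real.norm_eq_abs, Real.norm_of_nonneg hp.le] at hb
  have h1 := (abs_le.1 hb).1
  have hlam := h.lam_pos
  have hc : 0 < 1728 / lam ^ 3 := by positivity
  -- Even at `cos ξ = -1` the coefficient is at least `δ > 0`; half of it absorbs the error.
  have h2 : δ ≤ 20 / (2 * deriv F 1) ^ 2 + 1728 / lam ^ 3 * Real.cos ξ := by
    nlinarith [Real.neg_one_le_cos ξ]
  have h3 := mul_le_mul_of_nonneg_right h2 hp.le
  have h4 := mul_pos hδ0 hp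
  linarith

theorem eventually_pos {k : ℕ} (h : IsPrincipalRadialSeries (k + 7) lam F) :
    ∀ᶠ ξ in atTop, 0 < phaseIntegral F (k + 6) 0 F ξ := by
  have hd := h.deriv_ne_zero 1 ⟨zero_le_one, le_rfl⟩
  obtain ⟨u, hu, huv⟩ := h.isEquivalent.exists_eq_mul
  filter_upwards [huv, hu.eventually_const_lt one_half_lt_one, eventually_gt_atTop 0]
    with ξ h1 h2 hξ
  rw [h1, Pi.mul_apply]
  have hp : 0 < ξ ^ (-3 : ℝ) := Real.rpow_pos_of_pos hξ _
  have : 0 < u ξ := by linarith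
  positivity

end IsPrincipalRadialSeries

/-! ### Assembly of the theorem -/

theorem theorem2p1 (n : ℕ) (hn : 1 ≤ n) (lam : ℝ) (φ : ℝ → ℝ)
    (hφ : IsPrincipalRadialProfile n lam φ) :
    -- the number of sign changes
    (n ≤ 5 → numSignChanges (oscIntegral n φ) (Ioi 0) = ⊤) ∧
    (6 ≤ n → numSignChanges (oscIntegral n φ) (Ioi 0) < ⊤) ∧
    -- the asymptotic formulas as `ξ → ∞`
    (n = 1 →
      (fun ξ => oscIntegral n φ ξ
          - Real.sqrt (Real.pi / (2 * lam)) * Real.sin (ξ - Real.pi / 4) * ξ ^ (-(1 / 2) : ℝ))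
        =O[atTop] fun ξ : ℝ => ξ ^ (-1 : ℝ)) ∧
    (n = 2 →
      (fun ξ => oscIntegral n φ ξ - (-(2 / lam) * Real.cos ξ * ξ ^ (-1 : ℝ)))
        =O[atTop] fun ξ : ℝ => ξ ^ (-(3 / 2) : ℝ)) ∧
    (n = 3 →
      (fun ξ => oscIntegral n φ ξ
          - (-(3 / lam) * Real.sqrt (3 * Real.pi / (2 * lam)) * Real.cos (ξ - Real.pi / 4)
              * ξ ^ (-(3 / 2) : ℝ)))
        =O[atTop] fun ξ : ℝ => ξ ^ (-2 : ℝ)) ∧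
    (n = 4 →
      (fun ξ => oscIntegral n φ ξ - (-(32 / lam ^ 2) * Real.sin ξ * ξ ^ (-2 : ℝ)))
        =O[atTop] fun ξ : ℝ => ξ ^ (-(5 / 2) : ℝ)) ∧
    (n = 5 →
      (fun ξ => oscIntegral n φ ξ
          - (-(75 / lam ^ 2) * Real.sqrt (5 * Real.pi / (2 * lam)) * Real.sin (ξ - Real.pi / 4)
              * ξ ^ (-(5 / 2) : ℝ)))
        =O[atTop] fun ξ : ℝ => ξ ^ (-3 : ℝ)) ∧
    (n = 6 →
      (fun ξ => oscIntegral n φ ξ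
          - (20 / derivWithin φ (Icc 0 1) 1 ^ 2 + 1728 / lam ^ 3 * Real.cos ξ) * ξ ^ (-3 : ℝ))
        =O[atTop] (fun ξ : ℝ => ξ ^ (-(7 / 2) : ℝ)) ∧
      1728 / lam ^ 3 < 20 / derivWithin φ (Icc 0 1) 1 ^ 2) ∧
    (7 ≤ n →
      derivWithin φ (Icc 0 1) 1 ≠ 0 ∧
      oscIntegral n φ ~[atTop]
        fun ξ : ℝ => 4 * ((n : ℝ) - 1) / derivWithin φ (Icc 0 1) 1 ^ 2 * ξ ^ (-3 : ℝ)) := by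
  obtain ⟨F, h, hF⟩ := hφ.exists_series hn
  have hJ : oscIntegral n φ = phaseIntegral F (n - 1) 0 F :=
    funext (oscIntegral_eq_phaseIntegral n hF)
  have hd := h.derivWithin_eq hF
  have hd0 := h.deriv_ne_zero 1 ⟨zero_le_one, le_rfl⟩
  have hlam := h.lam_pos
  have hpi := Real.pi_pos
  have hcont : ContinuousOn φ (Icc 0 1) :=
    h.analyticOnNhd.continuousOn_comp_sq.congr hF
  have hana : AnalyticOnNhd ℝ (phaseIntegral F (n - 1) 0 F) univ :=
    hJ ▸ analyticOnNhd_oscIntegral n hcont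
  rw [hJ, hd]
  refine ⟨fun h5 => ?_, fun h6 => ?_, ?_, ?_, ?_, ?_, ?_, ?_, fun h7 => ⟨by simpa using hd0, ?_⟩⟩
  · obtain rfl | rfl | rfl | rfl | rfl : n = 1 ∨ n = 2 ∨ n = 3 ∨ n = 4 ∨ n = 5 := by omega
    · exact numSignChanges_eq_top_of_oscillation 0 (by positivity) (by norm_num) h.isBigO_one
    -- The shift `θ = -π/2` presents the cosine as a sine.
    · refine numSignChanges_eq_top_of_oscillation (p := -1) (A := -(2 / lam)) (θ := -(Real.pi / 2)) 0
        (neg_ne_zero.2 (by positivity)) (by norm_num) (h.isBigO_two.congr_left fun ξ => ?_)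
      rw [sub_neg_eq_add, Real.sin_add_pi_div_two]
    · refine numSignChanges_eq_top_of_oscillation
        (p := -(3 / 2)) (A := -(3 / lam) * Real.sqrt (3 * Real.pi / (2 * lam))) (θ := -(Real.pi / 4)) 0
        (mul_ne_zero (neg_ne_zero.2 (by positivity)) (by positivity)) (by norm_num)
        (h.isBigO_three.congr_left fun ξ => ?_)
      rw [← Real.sin_add_pi_div_two]
      congr 4
      ring
    · refine numSignChanges_eq_top_of_oscillation (p := -2) (A := -(32 / lam ^ 2)) (θ := 0) 0
        (neg_ne_zero.2 (by positivity)) (by norm_num) (h.isBigO_four.congr_left fun ξ => ?_)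
      rw [sub_zero]
    · exact numSignChanges_eq_top_of_oscillation 0
        (mul_ne_zero (neg_ne_zero.2 (by positivity)) (by positivity)) (by norm_num) h.isBigO_five
  · refine numSignChanges_lt_top_of_analytic hana 0 ?_
    obtain rfl | ⟨k, rfl⟩ : n = 6 ∨ ∃ k, n = k + 7 := by
      rcases h6.eq_or_lt with h' | h'
      · exact Or.inl h'.symm
      · exact Or.inr ⟨n - 7, by omega⟩
    · exact h.eventually_pos_six
    · exact h.eventually_pos
  · rintro rfl; exact h.isBigO_one
  · rintro rfl; exact h.isBigO_two
  · rintro rfl; exact h.isBigO_three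
  · rintro rfl; exact h.isBigO_four
  · rintro rfl; exact h.isBigO_five
  · rintro rfl; exact ⟨h.isBigO_six, h.six_lt⟩
  · obtain ⟨k, rfl⟩ : ∃ k, n = k + 7 := ⟨n - 7, by omega⟩
    have := h.isEquivalent
    have e : ((k + 7 : ℕ) : ℝ) - 1 = k + 6 := by push_cast; ring
    rw [e]
    exact this
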